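/- Let $N\ge 1$, let $I_1,\dots,I_N\subset\mathbb R$ be pairwise disjoint compact intervals of positive length, $I=\bigcup_i I_i$, and let $A$ be an $N\times N$ matrix with entries in $\{0,1\}$; write $i\rightsquigarrow j$ if $A_{i,j}=1$. For each $i\rightsquigarrow j$ let $\phi_{i,j}:I_i\to\phi_{i,j}(I_i)\subset\mathrm{Int}(I_j)$ be a $C^\infty$ diffeomorphism onto its image (so $\phi_{i,j}'\neq0$ on $I_i$), such that for some $0<\theta<1$ one has $|\phi_{i,j}'(x)|\le\theta$ for all $i\rightsquigarrow j$ and $x\in I_i$, and such that $\phi_{i,j}(I_i)\cap\phi_{k,l}(I_k)\ne\emptyset$ implies $(i,j)=(k,l)$. For $B\subset I$ put $\phi(B)=\bigcup_{i\rightsquigarrow j}\phi_{i,j}(B\cap I_i)$, and let $K=\bigcap_{n\ge0}\phi^n(I)$. Let $\tau\in C^\infty(I;\mathbb R)$ and let $F$ be the multivalued map of $T^*I=I\times\mathbb R$ given by $$F(x,\xi)=\Big\{\Big(\phi_{i,j}(x),\ \tfrac{1}{\phi_{i,j}'(x)}\,\xi+\tau'(\phi_{i,j}(x))\Big)\ :\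 x\in I_i,\ i\rightsquigarrow j\Big\}.$$ For $n\ge 0$ let $F^n(\rho)$ be the set of points reached from $\rho$ by $n$ iterations of $F$, and let $F^{-n}(\rho)=\{\rho'\in T^*I:\rho\in F^n(\rho')\}$. Define the trapped set in phase space $$\mathcal K=\{\rho\in T^*I:\ \exists\, C\subset T^*I\text{ compact},\ \forall n\in\mathbb Z,\ F^n(\rho)\cap C\neq\emptyset\},$$ and for $\varepsilon>0$ let $\mathcal K_\varepsilon$ be the set of $(x,\xi)\in T^*I$ such that $\max(|x-x_0|,|\xi-\xi_0|)\le\varepsilon$ for some $(x_0,\xi_0)\in\mathcal K$. Assume minimal captivity: there is $\varepsilon>0$ such that $\sharp\big(F(\rho)\cap\mathcal K_\varepsilon\big)\le1$ for all $\rho\in\mathcal K_\varepsilon$. Assume also that $A$ is symmetric and that $K\neq\emptyset$. Then $$\dim_M\mathcal K=2\dim_M K=2\dim_H K,$$ where $\dim_H$ is the Hausdorff dimension and $\dim_M$ is the upper Minkowski dimension: for $B\subset\mathbb R^d$, $\dim_M B=d-\sup\{s\in\mathbb R:\limsup_{\delta\downarrow0}\delta^{-s}\,\mathrm{Leb}(B_\delta)<\infty\}$,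 with $B_\delta=\{x\in\mathbb R^d:\mathrm{dist}(x,B)\le\delta\}$. -/

import Mathlib

open Set Filter Topology MeasureTheory
open scoped ContDiff ENNReal Matrix

noncomputable section

/-- The upper Minkowski codimension of `B`: the supremum of the real `s` such that
`limsup_{δ ↓ 0} δ ^ (-s) * Leb (B_δ) < ∞`, where `B_δ` is the closed `δ`-neighbourhood of `B`. -/
def minkowskiCodim {E : Type*} [PseudoEMetricSpace E] [MeasureSpace E] (B : Set E) : EReal :=
  sSup ((fun s : ℝ => (s : EReal)) ''
    {s : ℝ | limsup (fun δ : ℝ => ENNReal.ofReal (δ ^ (-s)) * volume (Metric.cthickening δ B))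
      (𝓝[>] 0) < ⊤})

/-- The upper Minkowski (box) dimension `d - codim_M B` of a subset of a `d`-dimensional
Euclidean space. -/
def minkowskiDim {E : Type*} [PseudoEMetricSpace E] [MeasureSpace E] [AddCommGroup E] [Module ℝ E]
    (B : Set E) : EReal :=
  ((Module.finrank ℝ E : ℝ) : EReal) - minkowskiCodim B

/-- An iterated function scheme on `N` disjoint compact intervals `[a i, b i]`, with adjacency
matrix `A`. The map `φ i j` is only relevant when `A i j = 1`, and then only on `[a i, b i]`. -/
structure IteratedFunctionScheme (N : ℕ) where
  one_le : 1 ≤ N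
  a : Fin N → ℝ
  b : Fin N → ℝ
  a_lt_b : ∀ i, a i < b i
  disjoint_intervals : ∀ i j, i ≠ j → Disjoint (Icc (a i) (b i)) (Icc (a j) (b j))
  A : Matrix (Fin N) (Fin N) ℕ
  A_zero_or_one : ∀ i j, A i j = 0 ∨ A i j = 1
  φ : Fin N → Fin N → ℝ → ℝ
  φ_smooth : ∀ i j, A i j = 1 → ContDiffOn ℝ ∞ (φ i j) (Icc (a i) (b i))
  φ_injOn : ∀ i j, A i j = 1 → InjOn (φ i j) (Icc (a i) (b i))
  φ_deriv_ne_zero : ∀ i j, A i j = 1 → ∀ x ∈ Icc (a i) (b i),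
    derivWithin (φ i j) (Icc (a i) (b i)) x ≠ 0
  φ_maps_interior : ∀ i j, A i j = 1 → φ i j '' Icc (a i) (b i) ⊆ interior (Icc (a j) (b j))
  φ_contraction : ∃ θ : ℝ, 0 < θ ∧ θ < 1 ∧ ∀ i j, A i j = 1 → ∀ x ∈ Icc (a i) (b i),
    |derivWithin (φ i j) (Icc (a i) (b i)) x| ≤ θ
  separation : ∀ i j k l, A i j = 1 → A k l = 1 →
    (φ i j '' Icc (a i) (b i) ∩ φ k l '' Icc (a k) (b k)).Nonempty → i = k ∧ j = l

namespace IteratedFunctionScheme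

variable {N : ℕ} (S : IteratedFunctionScheme N)

/-- The interval `I_i`. -/
def interval (i : Fin N) : Set ℝ := Icc (S.a i) (S.b i)

/-- The union `I` of the intervals `I_i`. -/
def I : Set ℝ := ⋃ i, S.interval i

/-- The image of a set under the multivalued map `φ = (φ_{i,j})`. -/
def image (s : Set ℝ) : Set ℝ :=
  {y | ∃ i j, S.A i j = 1 ∧ ∃ x ∈ s ∩ S.interval i, S.φ i j x = y}

/-- `K_n = φ^n (I)`. -/
def Kn (n : ℕ) : Set ℝ := S.image^[n] S.I

/-- The trapped set `K = ⋂ K_n`. -/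
def K : Set ℝ := ⋂ n, S.Kn n

/-- The phase space `T*I = I × ℝ`. -/
def phaseSpace : Set (ℝ × ℝ) := S.I ×ˢ univ

/-- The branch `F_{i,j}(x, ξ) = (x', ξ / φ_{i,j}'(x) + τ'(x'))`, `x' = φ_{i,j}(x)`, of the
canonical map associated to the roof function `τ`. -/
def branch (τ : ℝ → ℝ) (i j : Fin N) (p : ℝ × ℝ) : ℝ × ℝ :=
  (S.φ i j p.1,
    (derivWithin (S.φ i j) (S.interval i) p.1)⁻¹ * p.2 + derivWithin τ S.I (S.φ i j p.1))

/-- The multivalued canonical map `F : T*I → T*I`. -/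
def canonicalMap (τ : ℝ → ℝ) (p : ℝ × ℝ) : Set (ℝ × ℝ) :=
  {q | ∃ i j, S.A i j = 1 ∧ p.1 ∈ S.interval i ∧ q = S.branch τ i j p}

/-- The image of a set under `F`. -/
def canonicalImage (τ : ℝ → ℝ) (s : Set (ℝ × ℝ)) : Set (ℝ × ℝ) :=
  ⋃ p ∈ s, S.canonicalMap τ p

/-- The set `F^n (p)`, for `n ∈ ℤ`; for negative `n` it consists of the points `q` with
`p ∈ F^{|n|} (q)`. -/
def canonicalPow (τ : ℝ → ℝ) : ℤ → ℝ × ℝ → Set (ℝ × ℝ)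
  | Int.ofNat n, p => (S.canonicalImage τ)^[n] {p}
  | Int.negSucc n, p => {q | p ∈ (S.canonicalImage τ)^[n + 1] {q}}

/-- The trapped set `𝒦` in phase space. -/
def phaseTrapped (τ : ℝ → ℝ) : Set (ℝ × ℝ) :=
  {p | p ∈ S.phaseSpace ∧ ∃ C : Set (ℝ × ℝ), C ⊆ S.phaseSpace ∧ IsCompact C ∧
    ∀ n : ℤ, (S.canonicalPow τ n p ∩ C).Nonempty}

/-- The `ε`-neighbourhood `𝒦_ε` of `𝒦` in `T*I`. -/
def phaseTrappedNhd (τ : ℝ → ℝ) (ε : ℝ) : Set (ℝ × ℝ) :=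
  {p | p ∈ S.phaseSpace ∧ ∃ p₀ ∈ S.phaseTrapped τ, max |p.1 - p₀.1| |p.2 - p₀.2| ≤ ε}

/-- Minimal captivity. -/
def MinimallyCaptive (τ : ℝ → ℝ) : Prop :=
  ∃ ε : ℝ, 0 < ε ∧ ∀ p ∈ S.phaseTrappedNhd τ ε,
    (S.canonicalMap τ p ∩ S.phaseTrappedNhd τ ε).encard ≤ 1

/-- The trapped set `𝒦` as a subset of the Euclidean plane. -/
def phaseTrappedPlane (τ : ℝ → ℝ) : Set (EuclideanSpace ℝ (Fin 2)) :=
  (fun p : ℝ × ℝ => !₂[p.1, p.2]) '' S.phaseTrapped τ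

end IteratedFunctionScheme

end

-- All three dimensions are compared with one threshold, the supremum of the `t > 0` for which
-- `HasLoops t` holds: some vertex visited by `K` carries at least `r ^ (-t)` loops of a common
-- length that contract by no more than `r`. No pressure function is needed.
--
-- If `HasLoops t` holds, the return maps along the loops have separated images, and their limit set
-- in `K` is sent onto at least `[0, 1)` by a `t`-Hölder map, so `dimH K ≥ t`
-- (`LoopFamily.le_dimH`). In phase space, `x` records its past, while over a given `x` the
-- coordinate `ξ` records the future path, because the inverse branches of `F` contract `ξ`. Past
-- and future can be prescribed independently as words in the loops. Minimal captivity separates two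
-- points of a fibre with different futures (`MinimallyCaptive.exists_fiber_gap`), so `M` loops give
-- `M ^ (2 * m)` points separated at scale `r ^ m`, and the dimension of the phase space trapped set
-- is at least `2 * t`.
--
-- If `HasLoops t` fails, loops are few. Symmetry of `A` closes any path into a loop at bounded
-- cost, and bounded distortion makes derivatives along a path comparable over its initial interval.
-- Hence only `O(ρ ^ (-t'))` paths starting at a visited vertex have derivative at least `ρ`, for
-- each `t' > t` (`exists_card_paths_le`). One such path locates `x` up to `O(δ)` and a second one,
-- the future, locates `ξ`. This yields covers of `K` by `O(δ ^ (-t'))` balls and of the phase space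
-- trapped set by `O(δ ^ (-2 * t'))` balls.

-- Covers, packings and dimension.

section BoxCounting

variable {E : Type*} [NormedAddCommGroup E]

/-- `B` can be covered by `O(δ ^ (-t))` balls of radius `O(δ)`, for `0 < δ < 1`. -/
def CoverBound (B : Set E) (t : ℝ) : Prop :=
  ∃ C c : ℝ, 0 < c ∧ ∀ δ : ℝ, 0 < δ → δ < 1 → ∃ P : Finset E, (P.card : ℝ) ≤ C * δ ^ (-t) ∧
    ∀ x ∈ B, ∃ p ∈ P, dist x p ≤ c * δ

/-- For a sequence of scales `δ` tending to `0`, `B` contains at least `c * δ ^ (-t)` points with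
mutual distances at least `2 * δ`. -/
def PackingBound (B : Set E) (t : ℝ) : Prop :=
  ∃ c : ℝ, 0 < c ∧ ∃ δ : ℕ → ℝ, Tendsto δ atTop (𝓝[>] 0) ∧ ∀ m, ∃ (ι : Type) (_ : Fintype ι)
    (f : ι → E), (∀ a, f a ∈ B) ∧ (∀ a b, a ≠ b → 2 * δ m ≤ dist (f a) (f b)) ∧
      c * δ m ^ (-t) ≤ Fintype.card ι

theorem packingBound_zero {B : Set E} (hB : B.Nonempty) : PackingBound B 0 := by
  obtain ⟨x, hx⟩ := hB
  refine ⟨1, one_pos, fun n => 1 / ((n : ℝ) + 1), ?_, fun m => ⟨Unit, inferInstance, fun _ => x,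
    fun _ => hx, fun a b h => (h rfl).elim, by simp⟩⟩
  rw [tendsto_nhdsWithin_iff]
  exact ⟨tendsto_one_div_add_atTop_nhds_zero_nat, Eventually.of_forall fun n => by
    simp only [mem_Ioi]; positivity⟩

theorem CoverBound.dimH_le {B : Set E} {t : ℝ} (ht : 0 < t) (h : CoverBound B t) :
    dimH B ≤ ENNReal.ofReal t := by
  borelize E
  obtain ⟨C, c, hc, h⟩ := h
  -- The scales `1 / (n + 2)` start below `1`, as the cover bound requires.
  have hpos : ∀ n : ℕ, (0 : ℝ) < 1 / ((n : ℝ) + 2) := fun n => by positivity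
  have hlt : ∀ n : ℕ, 1 / ((n : ℝ) + 2) < 1 := fun n => by
    rw [div_lt_one (by positivity)]; have : (0 : ℝ) ≤ n := n.cast_nonneg
    linarith
  choose P hP hcov using fun n : ℕ => h (1 / ((n : ℝ) + 2)) (hpos n) (hlt n)
  have hdiam : ∀ n (p : E), Metric.ediam (Metric.closedBall p (c * (1 / ((n : ℝ) + 2)))) ≤
      ENNReal.ofReal (2 * c * (1 / ((n : ℝ) + 2))) := by
    intro n p
    refine Metric.ediam_le fun x hx y hy => ?_
    rw [edist_dist]
    refine ENNReal.ofReal_le_ofReal ?_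
    rw [Metric.mem_closedBall] at hx hy
    linarith [dist_triangle_right x y p]
  have key := Measure.hausdorffMeasure_le_liminf_sum (X := E) t B (l := atTop)
    (ι := fun n => {p // p ∈ P n})
    (fun n : ℕ => ENNReal.ofReal (2 * c * (1 / ((n : ℝ) + 2)))) (by
      rw [← ENNReal.ofReal_zero]
      refine ENNReal.tendsto_ofReal ?_
      have := (tendsto_one_div_add_atTop_nhds_zero_nat (𝕜 := ℝ)).comp (tendsto_add_atTop_nat 1)
      have h2 := this.const_mul (2 * c)
      rw [mul_zero] at h2
      refine h2.congr fun n => ?_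
      simp only [Function.comp_apply]; push_cast; ring_nf)
    (fun n p => Metric.closedBall p.1 (c * (1 / ((n : ℝ) + 2))))
    (Eventually.of_forall fun n p => hdiam n p.1)
    (Eventually.of_forall fun n x hx => by
      obtain ⟨p, hp, hxp⟩ := hcov n x hx
      exact mem_iUnion.2 ⟨⟨p, hp⟩, hxp⟩)
  have hfin : μH[t] B ≤ ENNReal.ofReal (C * (2 * c) ^ t) := by
    refine key.trans (liminf_le_of_le (by isBoundedDefault) fun b hb => ?_)
    obtain ⟨n, hn⟩ := hb.exists
    refine hn.trans ?_
    have h0 := hpos n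
    calc ∑ p : {p // p ∈ P n}, Metric.ediam (Metric.closedBall p.1 (c * (1 / ((n : ℝ) + 2)))) ^ t
        ≤ ∑ p : {p // p ∈ P n}, ENNReal.ofReal (2 * c * (1 / ((n : ℝ) + 2))) ^ t := by
          gcongr with p; exact hdiam n p.1
      _ = ENNReal.ofReal ((P n).card * (2 * c * (1 / ((n : ℝ) + 2))) ^ t) := by
          rw [Finset.sum_const, nsmul_eq_mul, ENNReal.ofReal_rpow_of_pos (by positivity),
            ENNReal.ofReal_mul (Nat.cast_nonneg _), ENNReal.ofReal_natCast]
          simp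
      _ ≤ ENNReal.ofReal (C * (2 * c) ^ t) := by
          refine ENNReal.ofReal_le_ofReal ?_
          calc (P n).card * (2 * c * (1 / ((n : ℝ) + 2))) ^ t
              ≤ (C * (1 / ((n : ℝ) + 2)) ^ (-t)) * (2 * c * (1 / ((n : ℝ) + 2))) ^ t := by
                gcongr; exact hP n
            _ = C * (2 * c) ^ t := by
                rw [Real.mul_rpow (by positivity) h0.le, Real.rpow_neg h0.le]
                have : (1 / ((n : ℝ) + 2)) ^ t ≠ 0 := (Real.rpow_pos_of_pos h0 t).ne'
                field_simp
  have := dimH_le_of_hausdorffMeasure_ne_top (s := B) (d := t.toNNReal) (by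
    rw [Real.coe_toNNReal t ht.le]
    exact (hfin.trans_lt ENNReal.ofReal_lt_top).ne)
  exact this

variable [NormedSpace ℝ E] [MeasureSpace E] [BorelSpace E] [FiniteDimensional ℝ E]
  [(volume : Measure E).IsAddHaarMeasure]

theorem CoverBound.minkowskiDim_le {B : Set E} {t : ℝ} (h : CoverBound B t) :
    minkowskiDim B ≤ (t : EReal) := by
  obtain ⟨C, c, hc, h⟩ := h
  set d := Module.finrank ℝ E with hd
  have hlim : limsup (fun δ : ℝ => ENNReal.ofReal (δ ^ (-((d : ℝ) - t))) *
      volume (Metric.cthickening δ B)) (𝓝[>] 0) < ⊤ := by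
    set V : ℝ≥0∞ := volume (Metric.closedBall (0 : E) 1) with hV
    have hVt : V < ⊤ := measure_closedBall_lt_top
    refine lt_of_le_of_lt (b := ENNReal.ofReal (C * (c + 2) ^ d) * V) ?_
      (ENNReal.mul_lt_top ENNReal.ofReal_lt_top hVt)
    refine limsup_le_of_le (by isBoundedDefault) ?_
    filter_upwards [Ioo_mem_nhdsGT (zero_lt_one (α := ℝ))] with δ hδ
    obtain ⟨P, hP, hcov⟩ := h δ hδ.1 hδ.2
    -- A point of the closed `δ`-neighbourhood is within `2 * δ` of an actual point of `B`, which is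
    -- within `c * δ` of a centre.
    have hsub : Metric.cthickening δ B ⊆ ⋃ p ∈ P, Metric.closedBall p ((c + 2) * δ) := by
      intro x hx
      have := Metric.cthickening_subset_thickening' (δ₂ := 2 * δ) (by linarith [hδ.1])
        (by linarith [hδ.1]) B hx
      obtain ⟨y, hy, hxy⟩ := Metric.mem_thickening_iff.1 this
      obtain ⟨p, hp, hyp⟩ := hcov y hy
      refine mem_iUnion₂.2 ⟨p, hp, ?_⟩
      rw [Metric.mem_closedBall]
      linarith [dist_triangle x y p]
    have hvol : volume (Metric.cthickening δ B) ≤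
        ENNReal.ofReal (P.card * ((c + 2) * δ) ^ d) * V := by
      refine (measure_mono hsub).trans ((measure_biUnion_finset_le P _).trans ?_)
      have : ∀ p ∈ P, volume (Metric.closedBall p ((c + 2) * δ)) =
          ENNReal.ofReal (((c + 2) * δ) ^ d) * V := fun p _ =>
        Measure.addHaar_closedBall' volume p (by have := hδ.1; positivity)
      rw [Finset.sum_congr rfl this, Finset.sum_const, nsmul_eq_mul, ← mul_assoc,
        ENNReal.ofReal_mul (by positivity), ENNReal.ofReal_natCast]
    have hδ0 := hδ.1
    calc ENNReal.ofReal (δ ^ (-((d : ℝ) - t))) * volume (Metric.cthickening δ B)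
        ≤ ENNReal.ofReal (δ ^ (-((d : ℝ) - t))) *
          (ENNReal.ofReal (P.card * ((c + 2) * δ) ^ d) * V) := by gcongr
      _ = ENNReal.ofReal (δ ^ (-((d : ℝ) - t)) * (P.card * ((c + 2) * δ) ^ d)) * V := by
          rw [← mul_assoc, ← ENNReal.ofReal_mul (by positivity)]
      _ ≤ ENNReal.ofReal (C * (c + 2) ^ d) * V := by
          refine mul_le_mul_left (ENNReal.ofReal_le_ofReal ?_) _
          calc δ ^ (-((d : ℝ) - t)) * (P.card * ((c + 2) * δ) ^ d)
              ≤ δ ^ (-((d : ℝ) - t)) * (C * δ ^ (-t) * ((c + 2) * δ) ^ d) := by gcongr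
            _ = C * (c + 2) ^ d * (δ ^ (-((d : ℝ) - t)) * δ ^ (-t) * δ ^ (d : ℝ)) := by
                rw [mul_pow, Real.rpow_natCast]; ring
            _ = C * (c + 2) ^ d := by
                rw [← Real.rpow_add hδ0, ← Real.rpow_add hδ0]
                ring_nf
                simp
  have hle : (((d : ℝ) - t : ℝ) : EReal) ≤ minkowskiCodim B := le_sSup ⟨_, hlim, rfl⟩
  unfold minkowskiDim
  rw [← hd]
  calc ((d : ℝ) : EReal) - minkowskiCodim B ≤ ((d : ℝ) : EReal) - (((d : ℝ) - t : ℝ) : EReal) :=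
        EReal.sub_le_sub le_rfl hle
    _ = (t : EReal) := by rw [← EReal.coe_sub]; congr 1; ring

/-- The balls of radius `δ m` about the packed points are disjoint, so the neighbourhood has volume
at least of order `δ m ^ (d - t)`. Any exponent `s > d - t` then makes the limsup infinite; a
sequence of scales suffices because the dimension is the upper one. -/
theorem PackingBound.le_minkowskiDim {B : Set E} {t : ℝ} (h : PackingBound B t) :
    (t : EReal) ≤ minkowskiDim B := by
  obtain ⟨c, hc, δ, hδ, h⟩ := h
  set d := Module.finrank ℝ E with hd
  have hδ0 : ∀ᶠ m in atTop, 0 < δ m := (tendsto_nhdsWithin_iff.1 hδ).2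
  set V : ℝ≥0∞ := volume (Metric.ball (0 : E) 1) with hV
  have hV0 : V ≠ 0 := (Metric.measure_ball_pos volume _ one_pos).ne'
  have hvol : ∀ m, 0 < δ m → ENNReal.ofReal (c * δ m ^ (-t) * δ m ^ d) * V ≤
      volume (Metric.cthickening (δ m) B) := by
    intro m hm
    obtain ⟨ι, _, f, hf, hsep, hcard⟩ := h m
    have hsub : ⋃ a, Metric.ball (f a) (δ m) ⊆ Metric.cthickening (δ m) B := by
      refine iUnion_subset fun a => ?_
      exact (Metric.ball_subset_thickening (hf a) _).trans (Metric.thickening_subset_cthickening _ _)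
    have hdisj : Pairwise (Function.onFun Disjoint fun a => Metric.ball (f a) (δ m)) :=
      fun a b hab => Metric.ball_disjoint_ball (by linarith [hsep a b hab])
    calc ENNReal.ofReal (c * δ m ^ (-t) * δ m ^ d) * V
        ≤ ENNReal.ofReal (Fintype.card ι * δ m ^ d) * V := by gcongr
      _ = volume (⋃ a, Metric.ball (f a) (δ m)) := by
          rw [measure_iUnion hdisj fun a => Metric.isOpen_ball.measurableSet, tsum_fintype]
          simp only [Measure.addHaar_ball_of_pos volume _ hm, Finset.sum_const, nsmul_eq_mul]
          rw [← mul_assoc, ENNReal.ofReal_mul (by positivity), ENNReal.ofReal_natCast]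
          rfl
      _ ≤ _ := measure_mono hsub
  have hle : minkowskiCodim B ≤ (((d : ℝ) - t : ℝ) : EReal) := by
    refine sSup_le ?_
    rintro _ ⟨s, hs, rfl⟩
    simp only [EReal.coe_le_coe_iff]
    by_contra! hlt
    simp only [mem_ofPred_eq] at hs
    obtain ⟨M, hM, hMt⟩ := exists_between hs
    have hev := hδ.eventually (eventually_lt_of_limsup_lt hM)
    have htop : Tendsto (fun m => ENNReal.ofReal (c * δ m ^ (-(s - (d - t)))) * V) atTop (𝓝 ⊤) := by
      have h1 : Tendsto (fun m => c * δ m ^ (-(s - (d - t)))) atTop atTop :=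
        ((tendsto_rpow_neg_nhdsGT_zero (by linarith)).comp hδ).const_mul_atTop hc
      have h2 := ENNReal.tendsto_ofReal_nhds_top.2 h1
      have := ENNReal.Tendsto.mul_const h2 (b := V) (Or.inl ENNReal.top_ne_zero)
      rwa [ENNReal.top_mul hV0] at this
    obtain ⟨m, hm1, hm2, hm3⟩ := (hev.and (hδ0.and (htop.eventually (lt_mem_nhds hMt)))).exists
    refine absurd (hm3.trans_le ?_) hm1.not_gt
    calc ENNReal.ofReal (c * δ m ^ (-(s - (d - t)))) * V
        = ENNReal.ofReal (δ m ^ (-s)) * (ENNReal.ofReal (c * δ m ^ (-t) * δ m ^ d) * V) := by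
          rw [← mul_assoc, ← ENNReal.ofReal_mul (by positivity), ← Real.rpow_natCast (δ m) d]
          congr 2
          rw [show -(s - ((d : ℝ) - t)) = -s + -t + d by ring, Real.rpow_add hm2, Real.rpow_add hm2]
          ring
      _ ≤ _ := by gcongr; exact hvol m hm2
  unfold minkowskiDim
  rw [← hd]
  calc (t : EReal) = ((d : ℝ) : EReal) - (((d : ℝ) - t : ℝ) : EReal) := by
        rw [← EReal.coe_sub]; congr 1; ring
    _ ≤ _ := EReal.sub_le_sub le_rfl hle

end BoxCounting

theorem dist_plane (a b c d : ℝ) :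
    dist (!₂[a, b] : EuclideanSpace ℝ (Fin 2)) !₂[c, d] = √((a - c) ^ 2 + (b - d) ^ 2) := by
  simp [EuclideanSpace.dist_eq, Real.dist_eq, Fin.sum_univ_two]

theorem abs_fst_sub_le_dist_plane (a b c d : ℝ) :
    |a - c| ≤ dist (!₂[a, b] : EuclideanSpace ℝ (Fin 2)) !₂[c, d] := by
  rw [dist_plane]
  exact Real.abs_le_sqrt (by nlinarith [sq_nonneg (b - d)])

theorem abs_snd_sub_le_dist_plane (a b c d : ℝ) :
    |b - d| ≤ dist (!₂[a, b] : EuclideanSpace ℝ (Fin 2)) !₂[c, d] := by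
  rw [dist_plane]
  exact Real.abs_le_sqrt (by nlinarith [sq_nonneg (a - c)])

theorem dist_plane_le (a b c d : ℝ) :
    dist (!₂[a, b] : EuclideanSpace ℝ (Fin 2)) !₂[c, d] ≤ |a - c| + |b - d| := by
  rw [dist_plane]
  refine Real.sqrt_le_iff.2 ⟨by positivity, ?_⟩
  rw [add_sq, sq_abs, sq_abs]
  have := mul_nonneg (abs_nonneg (a - c)) (abs_nonneg (b - d))
  linarith

-- Uniform constants from compactness.

namespace IteratedFunctionScheme

variable {N : ℕ} (S : IteratedFunctionScheme N)

/-- The derivative of `φ i j` on `I_i`. -/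
noncomputable def dφ (i j : Fin N) (x : ℝ) : ℝ := derivWithin (S.φ i j) (S.interval i) x

/-- Uniform constants controlling the scheme `S` and the roof function `τ`. -/
structure Constants (τ : ℝ → ℝ) where
  (θ κ L T₀ T₁ Δ g : ℝ)
  θ_pos : 0 < θ
  θ_lt_one : θ < 1
  κ_pos : 0 < κ
  L_nonneg : 0 ≤ L
  T₀_nonneg : 0 ≤ T₀
  T₁_nonneg : 0 ≤ T₁
  g_pos : 0 < g
  dφ_le : ∀ i j, S.A i j = 1 → ∀ x ∈ S.interval i, |S.dφ i j x| ≤ θ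
  le_dφ : ∀ i j, S.A i j = 1 → ∀ x ∈ S.interval i, κ ≤ |S.dφ i j x|
  dφ_lip : ∀ i j, S.A i j = 1 → ∀ x ∈ S.interval i, ∀ y ∈ S.interval i,
    |S.dφ i j x - S.dφ i j y| ≤ L * |x - y|
  dτ_le : ∀ x ∈ S.I, |derivWithin τ S.I x| ≤ T₀
  dτ_lip : ∀ i, ∀ x ∈ S.interval i, ∀ y ∈ S.interval i,
    |derivWithin τ S.I x - derivWithin τ S.I y| ≤ T₁ * |x - y|
  diam_le : ∀ i, ∀ x ∈ S.interval i, ∀ y ∈ S.interval i, |x - y| ≤ Δ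
  gap_interval : ∀ i j, i ≠ j → ∀ x ∈ S.interval i, ∀ y ∈ S.interval j, g ≤ |x - y|
  gap_image : ∀ i j k, S.A i k = 1 → S.A j k = 1 → i ≠ j → ∀ x ∈ S.interval i,
    ∀ y ∈ S.interval j, g ≤ |S.φ i k x - S.φ j k y|

variable {S}

theorem exists_uniform_bound {α : Type*} [Finite α] {P : α → ℝ → Prop}
    (hmono : ∀ a c d, c ≤ d → P a c → P a d) (h : ∀ a, ∃ c, P a c) : ∃ c, 0 ≤ c ∧ ∀ a, P a c := by
  choose f hf using h
  obtain ⟨M, hM⟩ := Finite.exists_le f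
  exact ⟨max M 0, le_max_right _ _, fun a => hmono a _ _ ((hM a).trans (le_max_left _ _)) (hf a)⟩

theorem exists_uniform_pos {α : Type*} [Finite α] {P : α → ℝ → Prop}
    (hanti : ∀ a c d, c ≤ d → P a d → P a c) (h : ∀ a, ∃ c, 0 < c ∧ P a c) :
    ∃ c, 0 < c ∧ ∀ a, P a c := by
  choose f hf0 hf using h
  obtain ⟨M, hM⟩ := Finite.exists_ge (fun a => (⟨f a, hf0 a⟩ : Ioi (0 : ℝ)))
  exact ⟨M.1, M.2, fun a => hanti a _ _ (hM a) (hf a)⟩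

theorem interval_subset_I (i : Fin N) : S.interval i ⊆ S.I := subset_iUnion _ i

theorem isCompact_interval (i : Fin N) : IsCompact (S.interval i) := isCompact_Icc

theorem isCompact_I : IsCompact S.I := isCompact_iUnion isCompact_interval

theorem uniqueDiffOn_interval (i : Fin N) : UniqueDiffOn ℝ (S.interval i) :=
  uniqueDiffOn_Icc (S.a_lt_b i)

theorem eq_of_mem_interval {i j : Fin N} {x : ℝ} (hi : x ∈ S.interval i) (hj : x ∈ S.interval j) :
    i = j := by
  by_contra h
  exact Set.disjoint_left.1 (S.disjoint_intervals i j h) hi hj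

theorem φ_mem {i j : Fin N} (h : S.A i j = 1) {x : ℝ} (hx : x ∈ S.interval i) :
    S.φ i j x ∈ S.interval j :=
  interior_subset (S.φ_maps_interior i j h (mem_image_of_mem _ hx))

theorem dφ_ne_zero {i j : Fin N} (h : S.A i j = 1) {x : ℝ} (hx : x ∈ S.interval i) :
    S.dφ i j x ≠ 0 := S.φ_deriv_ne_zero i j h x hx

theorem contDiffOn_dφ {i j : Fin N} (h : S.A i j = 1) :
    ContDiffOn ℝ 1 (S.dφ i j) (S.interval i) :=
  (S.φ_smooth i j h).derivWithin (uniqueDiffOn_interval i) (by norm_cast)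

/-- The mean value theorem; the bound on `|z - x|` lets distortion estimates replace the derivative
at `z` by the one at `x`. -/
theorem exists_φ_sub_eq {i j : Fin N} (h : S.A i j = 1) {x y : ℝ} (hx : x ∈ S.interval i)
    (hy : y ∈ S.interval i) :
    ∃ z ∈ S.interval i, |z - x| ≤ |x - y| ∧ S.φ i j x - S.φ i j y = S.dφ i j z * (x - y) := by
  have main : ∀ x ∈ S.interval i, ∀ y ∈ S.interval i, x < y →
      ∃ z ∈ Ioo x y, S.dφ i j z = (S.φ i j y - S.φ i j x) / (y - x) := by
    intro x hx y hy hxy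
    have hsub : Icc x y ⊆ S.interval i := Icc_subset_Icc hx.1 hy.2
    refine exists_hasDerivAt_eq_slope _ _ hxy ((S.φ_smooth i j h).continuousOn.mono hsub) ?_
    intro z hz
    have hz' : S.interval i ∈ 𝓝 z := Icc_mem_nhds (hx.1.trans_lt hz.1) (hz.2.trans_le hy.2)
    exact (((S.φ_smooth i j h).differentiableOn (by simp)) z
      (hsub (Ioo_subset_Icc_self hz))).hasDerivWithinAt.hasDerivAt hz'
  rcases lt_trichotomy x y with hlt | rfl | hlt
  · obtain ⟨z, hz, hd⟩ := main x hx y hy hlt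
    refine ⟨z, ⟨hx.1.trans hz.1.le, hz.2.le.trans hy.2⟩, ?_, ?_⟩
    · rw [abs_sub_comm x y, abs_of_pos (sub_pos.2 hz.1), abs_of_pos (sub_pos.2 hlt)]
      linarith [hz.2]
    · rw [hd]; field_simp [(sub_pos.2 hlt).ne']; ring
  · exact ⟨x, hx, by simp, by simp⟩
  · obtain ⟨z, hz, hd⟩ := main y hy x hx hlt
    refine ⟨z, ⟨hy.1.trans hz.1.le, hz.2.le.trans hx.2⟩, ?_, ?_⟩
    · rw [abs_sub_comm z x, abs_of_pos (sub_pos.2 hz.2), abs_of_pos (sub_pos.2 hlt)]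
      linarith [hz.1]
    · rw [hd]; field_simp [(sub_pos.2 hlt).ne']

/-- The other intervals form a closed set missing `x`. Hence derivatives within `I` and within `I_i`
agree on `I_i`. -/
theorem interval_eventuallyEq_I {i : Fin N} {x : ℝ} (hx : x ∈ S.interval i) :
    S.I =ᶠ[𝓝 x] S.interval i := by
  have hcl : IsClosed (⋃ j ∈ ({i}ᶜ : Set (Fin N)), S.interval j) :=
    (Set.toFinite _).isClosed_biUnion fun j _ => (isCompact_interval j).isClosed
  have hnot : x ∈ (⋃ j ∈ ({i}ᶜ : Set (Fin N)), S.interval j)ᶜ := by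
    simp only [mem_compl_iff, mem_iUnion, not_exists]
    exact fun j hj hxj => hj (eq_of_mem_interval hxj hx)
  filter_upwards [hcl.isOpen_compl.mem_nhds hnot] with y hy
  refine propext ⟨fun h => ?_, fun h => interval_subset_I i h⟩
  obtain ⟨j, hj⟩ := mem_iUnion.1 h
  by_cases hji : j = i
  · exact hji ▸ hj
  · exact (hy (mem_iUnion₂.2 ⟨j, hji, hj⟩)).elim

theorem contDiffOn_dτ {τ : ℝ → ℝ} (hτ : ContDiffOn ℝ ∞ τ S.I) (i : Fin N) :
    ContDiffOn ℝ 1 (derivWithin τ S.I) (S.interval i) := by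
  have h1 : ContDiffOn ℝ 1 (derivWithin τ (S.interval i)) (S.interval i) :=
    (hτ.mono (interval_subset_I i)).derivWithin (uniqueDiffOn_interval i)
      (by norm_cast)
  exact h1.congr fun x hx => derivWithin_congr_set (interval_eventuallyEq_I hx)

theorem exists_lipschitz_of_contDiffOn {i : Fin N} {f : ℝ → ℝ}
    (hf : ContDiffOn ℝ 1 f (S.interval i)) :
    ∃ L : ℝ, ∀ x ∈ S.interval i, ∀ y ∈ S.interval i, |f x - f y| ≤ L * |x - y| := by
  obtain ⟨K, hK⟩ := hf.exists_lipschitzOnWith one_ne_zero (convex_Icc _ _) (isCompact_interval i)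
  exact ⟨K, fun x hx y hy => by simpa [Real.dist_eq] using hK.dist_le_mul x hx y hy⟩

theorem exists_gap {s t : Set ℝ} (hs : IsCompact s) (ht : IsCompact t) (h : Disjoint s t) :
    ∃ c, 0 < c ∧ ∀ x ∈ s, ∀ y ∈ t, c ≤ |x - y| := by
  obtain ⟨r, hr, hlt⟩ := Metric.exists_pos_forall_lt_edist hs ht.isClosed h
  refine ⟨r, hr, fun x hx y hy => ?_⟩
  have := hlt x hx y hy
  rw [edist_nndist] at this
  rw [← Real.dist_eq]
  exact_mod_cast this.le

theorem nonempty_constants {τ : ℝ → ℝ} (hτ : ContDiffOn ℝ ∞ τ S.I) : Nonempty (S.Constants τ) := by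
  obtain ⟨θ, hθ0, hθ1, hθ⟩ := S.φ_contraction
  obtain ⟨κ, hκ0, hκ⟩ := exists_uniform_pos (α := Fin N × Fin N)
    (P := fun p c => S.A p.1 p.2 = 1 → ∀ x ∈ S.interval p.1, c ≤ |S.dφ p.1 p.2 x|)
    (fun p c d hcd hd h x hx => hcd.trans (hd h x hx)) (fun p => by
      by_cases h : S.A p.1 p.2 = 1
      · have hcont : ContinuousOn (fun x => |S.dφ p.1 p.2 x|) (S.interval p.1) :=
          (contDiffOn_dφ h).continuousOn.abs
        obtain ⟨x, hx, hmin⟩ := (isCompact_interval p.1).exists_isMinOn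
          ⟨S.a p.1, left_mem_Icc.2 (S.a_lt_b _).le⟩ hcont
        exact ⟨_, abs_pos.2 (dφ_ne_zero h hx), fun _ y hy => hmin hy⟩
      · exact ⟨1, one_pos, fun h' => (h h').elim⟩)
  obtain ⟨L, hL0, hL⟩ := exists_uniform_bound (α := Fin N × Fin N)
    (P := fun p c => S.A p.1 p.2 = 1 → ∀ x ∈ S.interval p.1, ∀ y ∈ S.interval p.1,
      |S.dφ p.1 p.2 x - S.dφ p.1 p.2 y| ≤ c * |x - y|)
    (fun p c d hcd hd h x hx y hy => (hd h x hx y hy).trans (by gcongr)) (fun p => by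
      by_cases h : S.A p.1 p.2 = 1
      · obtain ⟨L, hL⟩ := exists_lipschitz_of_contDiffOn (contDiffOn_dφ h)
        exact ⟨L, fun _ => hL⟩
      · exact ⟨1, fun h' => (h h').elim⟩)
  obtain ⟨T₁, hT₁0, hT₁⟩ := exists_uniform_bound (α := Fin N)
    (P := fun i c => ∀ x ∈ S.interval i, ∀ y ∈ S.interval i,
      |derivWithin τ S.I x - derivWithin τ S.I y| ≤ c * |x - y|)
    (fun p c d hcd hd x hx y hy => (hd x hx y hy).trans (by gcongr))
    (fun i => exists_lipschitz_of_contDiffOn (contDiffOn_dτ hτ i))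
  obtain ⟨T₀, hT₀0, hT₀⟩ := exists_uniform_bound (α := Fin N)
    (P := fun i c => ∀ x ∈ S.interval i, |derivWithin τ S.I x| ≤ c)
    (fun p c d hcd hd x hx => (hd x hx).trans hcd)
    (fun i => by
      obtain ⟨C, hC⟩ := (isCompact_interval i).exists_bound_of_continuousOn
        (contDiffOn_dτ hτ i).continuousOn
      exact ⟨C, hC⟩)
  obtain ⟨Δ, -, hΔ⟩ := exists_uniform_bound (α := Fin N)
    (P := fun i c => ∀ x ∈ S.interval i, ∀ y ∈ S.interval i, |x - y| ≤ c)
    (fun p c d hcd hd x hx y hy => (hd x hx y hy).trans hcd)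
    (fun i => ⟨S.b i - S.a i, fun x hx y hy => by
      rw [abs_le]; constructor <;> linarith [hx.1, hx.2, hy.1, hy.2]⟩)
  obtain ⟨g₁, hg₁0, hg₁⟩ := exists_uniform_pos (α := Fin N × Fin N)
    (P := fun p c => p.1 ≠ p.2 → ∀ x ∈ S.interval p.1, ∀ y ∈ S.interval p.2, c ≤ |x - y|)
    (fun p c d hcd hd h x hx y hy => hcd.trans (hd h x hx y hy)) (fun p => by
      by_cases h : p.1 = p.2
      · exact ⟨1, one_pos, fun h' => (h' h).elim⟩
      · obtain ⟨c, hc, hgap⟩ := exists_gap (isCompact_interval (S := S) p.1)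
          (isCompact_interval p.2) (S.disjoint_intervals _ _ h)
        exact ⟨c, hc, fun _ => hgap⟩)
  obtain ⟨g₂, hg₂0, hg₂⟩ := exists_uniform_pos (α := Fin N × Fin N × Fin N)
    (P := fun p c => S.A p.1 p.2.2 = 1 → S.A p.2.1 p.2.2 = 1 → p.1 ≠ p.2.1 →
      ∀ x ∈ S.interval p.1, ∀ y ∈ S.interval p.2.1, c ≤ |S.φ p.1 p.2.2 x - S.φ p.2.1 p.2.2 y|)
    (fun p c d hcd hd h h' h'' x hx y hy => hcd.trans (hd h h' h'' x hx y hy)) (fun p => by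
      by_cases h : S.A p.1 p.2.2 = 1 ∧ S.A p.2.1 p.2.2 = 1 ∧ p.1 ≠ p.2.1
      · have hdisj : Disjoint (S.φ p.1 p.2.2 '' S.interval p.1)
            (S.φ p.2.1 p.2.2 '' S.interval p.2.1) := by
          rw [Set.disjoint_iff_inter_eq_empty, ← Set.not_nonempty_iff_eq_empty]
          exact fun hne => h.2.2 (S.separation _ _ _ _ h.1 h.2.1 hne).1
        obtain ⟨c, hc, hgap⟩ := exists_gap
          ((isCompact_interval (S := S) p.1).image_of_continuousOn (S.φ_smooth _ _ h.1).continuousOn)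
          ((isCompact_interval (S := S) p.2.1).image_of_continuousOn
            (S.φ_smooth _ _ h.2.1).continuousOn) hdisj
        exact ⟨c, hc, fun _ _ _ x hx y hy => hgap _ (mem_image_of_mem _ hx) _
          (mem_image_of_mem _ hy)⟩
      · exact ⟨1, one_pos, fun h₁ h₂ h₃ => (h ⟨h₁, h₂, h₃⟩).elim⟩)
  exact ⟨{
    θ := θ, κ := κ, L := L, T₀ := T₀, T₁ := T₁, Δ := Δ, g := min g₁ g₂
    θ_pos := hθ0
    θ_lt_one := hθ1
    κ_pos := hκ0
    L_nonneg := hL0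
    T₀_nonneg := hT₀0
    T₁_nonneg := hT₁0
    g_pos := lt_min hg₁0 hg₂0
    dφ_le := fun i j h x hx => hθ i j h x hx
    le_dφ := fun i j => hκ (i, j)
    dφ_lip := fun i j => hL (i, j)
    dτ_le := fun x hx => by
      obtain ⟨i, hi⟩ := mem_iUnion.1 hx
      exact hT₀ i x hi
    dτ_lip := hT₁
    diam_le := hΔ
    gap_interval := fun i j h x hx y hy => (min_le_left _ _).trans (hg₁ (i, j) h x hx y hy)
    gap_image := fun i j k h₁ h₂ h₃ x hx y hy =>
      (min_le_right _ _).trans (hg₂ (i, j, k) h₁ h₂ h₃ x hx y hy) }⟩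

end IteratedFunctionScheme

-- Paths, their maps, and pull-back of the fibre coordinate.

namespace IteratedFunctionScheme

section Words

variable {N : ℕ} (S : IteratedFunctionScheme N)

/-- `i :: l` is a path of the directed graph with adjacency matrix `A`. -/
def IsPath : Fin N → List (Fin N) → Prop
  | _, [] => True
  | i, j :: l => S.A i j = 1 ∧ IsPath j l

/-- The last vertex of `i :: l`. -/
def endpoint : Fin N → List (Fin N) → Fin N
  | i, [] => i
  | _, j :: l => endpoint j l

/-- The composition of the maps `φ` along the path `i :: l`. -/
def wordMap : Fin N → List (Fin N) → ℝ → ℝ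
  | _, [], x => x
  | i, j :: l, x => wordMap j l (S.φ i j x)

/-- The derivative of `wordMap i l`. -/
noncomputable def wordDeriv : Fin N → List (Fin N) → ℝ → ℝ
  | _, [], _ => 1
  | i, j :: l, x => S.dφ i j x * wordDeriv j l (S.φ i j x)

/-- The second coordinate of the preimage of `(wordMap i l x, η)` under the branch of the iterated
canonical map along the path `i :: l`. -/
noncomputable def pull (τ : ℝ → ℝ) : Fin N → List (Fin N) → ℝ → ℝ → ℝ
  | _, [], _, η => η
  | i, j :: l, x, η =>
    S.dφ i j x * (pull τ j l (S.φ i j x) η - derivWithin τ S.I (S.φ i j x))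

variable {S}

theorem endpoint_append (i : Fin N) (l l' : List (Fin N)) :
    endpoint i (l ++ l') = endpoint (endpoint i l) l' := by
  induction l generalizing i with
  | nil => rfl
  | cons j l ih => exact ih j

theorem isPath_append {i : Fin N} {l l' : List (Fin N)} :
    S.IsPath i (l ++ l') ↔ S.IsPath i l ∧ S.IsPath (endpoint i l) l' := by
  induction l generalizing i with
  | nil => simp [IsPath, endpoint]
  | cons j l ih => simp [IsPath, endpoint, ih, and_assoc]

theorem wordMap_append (i : Fin N) (l l' : List (Fin N)) (x : ℝ) :
    S.wordMap i (l ++ l') x = S.wordMap (endpoint i l) l' (S.wordMap i l x) := by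
  induction l generalizing i x with
  | nil => rfl
  | cons j l ih => exact ih j _

theorem wordDeriv_append (i : Fin N) (l l' : List (Fin N)) (x : ℝ) :
    S.wordDeriv i (l ++ l') x =
      S.wordDeriv i l x * S.wordDeriv (endpoint i l) l' (S.wordMap i l x) := by
  induction l generalizing i x with
  | nil => simp [wordDeriv, wordMap, endpoint]
  | cons j l ih => simp [wordDeriv, wordMap, endpoint, ih, mul_assoc]

theorem pull_append (τ : ℝ → ℝ) (i : Fin N) (l l' : List (Fin N)) (x η : ℝ) :
    S.pull τ i (l ++ l') x η =
      S.pull τ i l x (S.pull τ (endpoint i l) l' (S.wordMap i l x) η) := by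
  induction l generalizing i x with
  | nil => rfl
  | cons j l ih => simp [pull, wordMap, endpoint, ih]

/-- Pulling back is affine in the fibre coordinate, with slope the derivative of the word: the
contraction of `x` forwards is the contraction of `ξ` backwards. -/
theorem pull_sub_pull (τ : ℝ → ℝ) (i : Fin N) (l : List (Fin N)) (x η η' : ℝ) :
    S.pull τ i l x η - S.pull τ i l x η' = S.wordDeriv i l x * (η - η') := by
  induction l generalizing i x with
  | nil => simp [pull, wordDeriv]
  | cons j l ih =>
    simp only [pull, wordDeriv]
    rw [mul_assoc, ← ih]
    ring

theorem wordMap_mem {i : Fin N} {l : List (Fin N)} (h : S.IsPath i l) {x : ℝ}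
    (hx : x ∈ S.interval i) : S.wordMap i l x ∈ S.interval (endpoint i l) := by
  induction l generalizing i x with
  | nil => exact hx
  | cons j l ih => exact ih h.2 (φ_mem h.1 hx)

theorem exists_reverse_path (hA : S.A.IsSymm) {i : Fin N} {l : List (Fin N)} (h : S.IsPath i l) :
    ∃ l', S.IsPath (endpoint i l) l' ∧ endpoint (endpoint i l) l' = i := by
  induction l generalizing i with
  | nil => exact ⟨[], trivial, rfl⟩
  | cons j l ih =>
    obtain ⟨l', h₁, h₂⟩ := ih h.2
    refine ⟨l' ++ [i], isPath_append.2 ⟨h₁, ?_⟩, ?_⟩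
    · change S.IsPath (endpoint (endpoint j l) l') [i]
      rw [h₂]
      exact ⟨(hA.apply i j).trans h.1, trivial⟩
    · rw [endpoint_append]; rfl

end Words

-- Bounded distortion and uniform bounds along paths.

namespace Constants

variable {N : ℕ} {S : IteratedFunctionScheme N} {τ : ℝ → ℝ} (c : S.Constants τ)

theorem abs_φ_sub_le {i j : Fin N} (h : S.A i j = 1) {x y : ℝ} (hx : x ∈ S.interval i)
    (hy : y ∈ S.interval i) : |S.φ i j x - S.φ i j y| ≤ c.θ * |x - y| := by
  obtain ⟨z, hz, -, he⟩ := exists_φ_sub_eq h hx hy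
  rw [he, abs_mul]
  gcongr
  exact c.dφ_le i j h z hz

theorem le_abs_φ_sub {i j : Fin N} (h : S.A i j = 1) {x y : ℝ} (hx : x ∈ S.interval i)
    (hy : y ∈ S.interval i) : c.κ * |x - y| ≤ |S.φ i j x - S.φ i j y| := by
  obtain ⟨z, hz, -, he⟩ := exists_φ_sub_eq h hx hy
  rw [he, abs_mul]
  gcongr
  exact c.le_dφ i j h z hz

theorem abs_wordMap_sub_le_pow {i : Fin N} {l : List (Fin N)} (h : S.IsPath i l) {x y : ℝ}
    (hx : x ∈ S.interval i) (hy : y ∈ S.interval i) :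
    |S.wordMap i l x - S.wordMap i l y| ≤ c.θ ^ l.length * |x - y| := by
  induction l generalizing i x y with
  | nil => simp [wordMap]
  | cons j l ih =>
    refine (ih h.2 (φ_mem h.1 hx) (φ_mem h.1 hy)).trans ?_
    rw [List.length_cons, pow_succ, mul_assoc]
    have := c.θ_pos
    gcongr
    exact c.abs_φ_sub_le h.1 hx hy

theorem le_abs_wordMap_sub {i : Fin N} {l : List (Fin N)} (h : S.IsPath i l) {x y : ℝ}
    (hx : x ∈ S.interval i) (hy : y ∈ S.interval i) :
    c.κ ^ l.length * |x - y| ≤ |S.wordMap i l x - S.wordMap i l y| := by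
  induction l generalizing i x y with
  | nil => simp [wordMap]
  | cons j l ih =>
    refine le_trans ?_ (ih h.2 (φ_mem h.1 hx) (φ_mem h.1 hy))
    rw [List.length_cons, pow_succ, mul_assoc]
    have := c.κ_pos
    gcongr
    exact c.le_abs_φ_sub h.1 hx hy

theorem abs_wordDeriv_le {i : Fin N} {l : List (Fin N)} (h : S.IsPath i l) {x : ℝ}
    (hx : x ∈ S.interval i) : |S.wordDeriv i l x| ≤ c.θ ^ l.length := by
  induction l generalizing i x with
  | nil => simp [wordDeriv]
  | cons j l ih =>
    simp only [wordDeriv, abs_mul, List.length_cons, pow_succ']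
    have := c.θ_pos
    gcongr
    · exact c.dφ_le i j h.1 x hx
    · exact ih h.2 (φ_mem h.1 hx)

theorem le_abs_wordDeriv {i : Fin N} {l : List (Fin N)} (h : S.IsPath i l) {x : ℝ}
    (hx : x ∈ S.interval i) : c.κ ^ l.length ≤ |S.wordDeriv i l x| := by
  induction l generalizing i x with
  | nil => simp [wordDeriv]
  | cons j l ih =>
    simp only [wordDeriv, abs_mul, List.length_cons, pow_succ']
    have := c.κ_pos
    gcongr
    · exact c.le_dφ i j h.1 x hx
    · exact ih h.2 (φ_mem h.1 hx)

/-- The exponential rate of distortion. -/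
noncomputable def β : ℝ := c.L / c.κ / (1 - c.θ)

theorem β_nonneg : 0 ≤ c.β :=
  div_nonneg (div_nonneg c.L_nonneg c.κ_pos.le) (sub_nonneg.2 c.θ_lt_one.le)

/-- One step costs distortion `L / κ` and shrinks distances by `θ`, so this fixed-point identity is
what closes the inductions on words. -/
theorem L_div_add : c.L / c.κ + c.β * c.θ = c.β := by
  have := (sub_pos.2 c.θ_lt_one).ne'
  have := c.κ_pos.ne'
  unfold β
  field_simp
  ring

theorem abs_dφ_le_exp {i j : Fin N} (h : S.A i j = 1) {x y : ℝ} (hx : x ∈ S.interval i)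
    (hy : y ∈ S.interval i) :
    |S.dφ i j x| ≤ Real.exp (c.L / c.κ * |x - y|) * |S.dφ i j y| := by
  have h1 : |S.dφ i j x| ≤ |S.dφ i j y| + c.L * |x - y| := by
    have := abs_sub_abs_le_abs_sub (S.dφ i j x) (S.dφ i j y)
    linarith [c.dφ_lip i j h x hx y hy]
  have h2 := c.le_dφ i j h y hy
  have hL := c.L_nonneg
  have hκ := c.κ_pos
  calc |S.dφ i j x| ≤ |S.dφ i j y| + c.L * |x - y| := h1
    _ = |S.dφ i j y| + c.L / c.κ * |x - y| * c.κ := by field_simp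
    _ ≤ |S.dφ i j y| + c.L / c.κ * |x - y| * |S.dφ i j y| := by gcongr
    _ = (c.L / c.κ * |x - y| + 1) * |S.dφ i j y| := by ring
    _ ≤ _ := by gcongr; exact Real.add_one_le_exp _

theorem abs_wordDeriv_le_exp {i : Fin N} {l : List (Fin N)} (h : S.IsPath i l) {x y : ℝ}
    (hx : x ∈ S.interval i) (hy : y ∈ S.interval i) :
    |S.wordDeriv i l x| ≤ Real.exp (c.β * |x - y|) * |S.wordDeriv i l y| := by
  induction l generalizing i x y with
  | nil => simpa [wordDeriv] using mul_nonneg c.β_nonneg (abs_nonneg _)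
  | cons j l ih =>
    simp only [wordDeriv, abs_mul]
    have hβ := c.β_nonneg
    calc _ ≤ (Real.exp (c.L / c.κ * |x - y|) * |S.dφ i j y|) *
          (Real.exp (c.β * |S.φ i j x - S.φ i j y|) * |S.wordDeriv j l (S.φ i j y)|) := by
          gcongr
          · exact c.abs_dφ_le_exp h.1 hx hy
          · exact ih h.2 (φ_mem h.1 hx) (φ_mem h.1 hy)
      _ ≤ (Real.exp (c.L / c.κ * |x - y|) * |S.dφ i j y|) *
          (Real.exp (c.β * (c.θ * |x - y|)) * |S.wordDeriv j l (S.φ i j y)|) := by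
          gcongr
          exact c.abs_φ_sub_le h.1 hx hy
      _ = Real.exp (c.L / c.κ * |x - y| + c.β * (c.θ * |x - y|)) *
          (|S.dφ i j y| * |S.wordDeriv j l (S.φ i j y)|) := by rw [Real.exp_add]; ring
      _ = _ := by
          rw [show c.L / c.κ * |x - y| + c.β * (c.θ * |x - y|) = (c.L / c.κ + c.β * c.θ) * |x - y|
            by ring, c.L_div_add]

/-- The mean value theorem is applied one letter at a time, so the composite never has to be
differentiated. -/
theorem abs_wordMap_sub_le_exp {i : Fin N} {l : List (Fin N)} (h : S.IsPath i l) {x y : ℝ}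
    (hx : x ∈ S.interval i) (hy : y ∈ S.interval i) :
    |S.wordMap i l x - S.wordMap i l y| ≤
      Real.exp (c.β * |x - y|) * |S.wordDeriv i l x| * |x - y| := by
  induction l generalizing i x y with
  | nil =>
    simp only [wordMap, wordDeriv, abs_one, mul_one]
    exact le_mul_of_one_le_left (abs_nonneg _)
      (Real.one_le_exp (mul_nonneg c.β_nonneg (abs_nonneg _)))
  | cons j l ih =>
    simp only [wordMap, wordDeriv, abs_mul]
    have hβ := c.β_nonneg
    have hL := c.L_nonneg
    have hκ := c.κ_pos
    obtain ⟨z, hz, hzx, he⟩ := exists_φ_sub_eq h.1 hx hy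
    calc _ ≤ Real.exp (c.β * |S.φ i j x - S.φ i j y|) * |S.wordDeriv j l (S.φ i j x)| *
          |S.φ i j x - S.φ i j y| := ih h.2 (φ_mem h.1 hx) (φ_mem h.1 hy)
      _ ≤ Real.exp (c.β * (c.θ * |x - y|)) * |S.wordDeriv j l (S.φ i j x)| *
          ((Real.exp (c.L / c.κ * |x - y|) * |S.dφ i j x|) * |x - y|) := by
          gcongr
          · exact c.abs_φ_sub_le h.1 hx hy
          · rw [he, abs_mul]
            gcongr
            refine (c.abs_dφ_le_exp h.1 hz hx).trans ?_
            gcongr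
      _ = Real.exp (c.L / c.κ * |x - y| + c.β * (c.θ * |x - y|)) *
          (|S.dφ i j x| * |S.wordDeriv j l (S.φ i j x)|) * |x - y| := by rw [Real.exp_add]; ring
      _ = _ := by
          rw [show c.L / c.κ * |x - y| + c.β * (c.θ * |x - y|) = (c.L / c.κ + c.β * c.θ) * |x - y|
            by ring, c.L_div_add]

theorem le_abs_wordMap_sub_exp {i : Fin N} {l : List (Fin N)} (h : S.IsPath i l) {x y : ℝ}
    (hx : x ∈ S.interval i) (hy : y ∈ S.interval i) :
    |S.wordDeriv i l x| * |x - y| ≤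
      Real.exp (c.β * |x - y|) * |S.wordMap i l x - S.wordMap i l y| := by
  induction l generalizing i x y with
  | nil =>
    simp only [wordMap, wordDeriv, abs_one, one_mul]
    exact le_mul_of_one_le_left (abs_nonneg _)
      (Real.one_le_exp (mul_nonneg c.β_nonneg (abs_nonneg _)))
  | cons j l ih =>
    simp only [wordMap, wordDeriv, abs_mul]
    have hβ := c.β_nonneg
    have hL := c.L_nonneg
    have hκ := c.κ_pos
    obtain ⟨z, hz, hzx, he⟩ := exists_φ_sub_eq h.1 hx hy
    calc _ ≤ (Real.exp (c.L / c.κ * |x - y|) * |S.dφ i j z|) * |S.wordDeriv j l (S.φ i j x)| *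
          |x - y| := by
          gcongr
          refine (c.abs_dφ_le_exp h.1 hx hz).trans ?_
          rw [abs_sub_comm x z]
          gcongr
      _ = Real.exp (c.L / c.κ * |x - y|) * (|S.wordDeriv j l (S.φ i j x)| *
          |S.φ i j x - S.φ i j y|) := by rw [he, abs_mul]; ring
      _ ≤ Real.exp (c.L / c.κ * |x - y|) * (Real.exp (c.β * |S.φ i j x - S.φ i j y|) *
          |S.wordMap j l (S.φ i j x) - S.wordMap j l (S.φ i j y)|) := by
          exact mul_le_mul_of_nonneg_left (ih h.2 (φ_mem h.1 hx) (φ_mem h.1 hy))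
            (Real.exp_pos _).le
      _ ≤ Real.exp (c.L / c.κ * |x - y|) * (Real.exp (c.β * (c.θ * |x - y|)) *
          |S.wordMap j l (S.φ i j x) - S.wordMap j l (S.φ i j y)|) := by
          gcongr
          exact c.abs_φ_sub_le h.1 hx hy
      _ = Real.exp (c.L / c.κ * |x - y| + c.β * (c.θ * |x - y|)) *
          |S.wordMap j l (S.φ i j x) - S.wordMap j l (S.φ i j y)| := by rw [Real.exp_add]; ring
      _ = _ := by
          rw [show c.L / c.κ * |x - y| + c.β * (c.θ * |x - y|) = (c.L / c.κ + c.β * c.θ) * |x - y|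
            by ring, c.L_div_add]

/-- The distortion constant. -/
noncomputable def Q : ℝ := Real.exp (c.β * c.Δ)

theorem Q_pos : 0 < c.Q := Real.exp_pos _

theorem exp_le_Q {i : Fin N} {x y : ℝ} (hx : x ∈ S.interval i) (hy : y ∈ S.interval i) :
    Real.exp (c.β * |x - y|) ≤ c.Q :=
  Real.exp_le_exp.2 (mul_le_mul_of_nonneg_left (c.diam_le i x hx y hy) c.β_nonneg)

theorem abs_wordDeriv_le_Q {i : Fin N} {l : List (Fin N)} (h : S.IsPath i l) {x y : ℝ}
    (hx : x ∈ S.interval i) (hy : y ∈ S.interval i) :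
    |S.wordDeriv i l x| ≤ c.Q * |S.wordDeriv i l y| :=
  (c.abs_wordDeriv_le_exp h hx hy).trans
    (mul_le_mul_of_nonneg_right (c.exp_le_Q hx hy) (abs_nonneg _))

theorem abs_wordMap_sub_le_Q {i : Fin N} {l : List (Fin N)} (h : S.IsPath i l) {x y : ℝ}
    (hx : x ∈ S.interval i) (hy : y ∈ S.interval i) :
    |S.wordMap i l x - S.wordMap i l y| ≤ c.Q * |S.wordDeriv i l x| * |x - y| :=
  (c.abs_wordMap_sub_le_exp h hx hy).trans (by gcongr; exact c.exp_le_Q hx hy)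

theorem le_abs_wordMap_sub_Q {i : Fin N} {l : List (Fin N)} (h : S.IsPath i l) {x y : ℝ}
    (hx : x ∈ S.interval i) (hy : y ∈ S.interval i) :
    |S.wordDeriv i l x| * |x - y| ≤ c.Q * |S.wordMap i l x - S.wordMap i l y| :=
  (c.le_abs_wordMap_sub_exp h hx hy).trans (by gcongr; exact c.exp_le_Q hx hy)

/-- After the last position where the vertex sequences differ, both points follow the same maps,
each shrinking distances by at most `κ`. At that position the gap comes from disjoint intervals, or
from disjoint images in a common interval. The minimum with `1` is there because `κ ≤ 1` is not
among the constants' properties. -/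
theorem gap_wordMap {i i' : Fin N} {l l' : List (Fin N)} (hlen : l.length = l'.length)
    (h : S.IsPath i l) (h' : S.IsPath i' l') (hne : i ≠ i' ∨ l ≠ l') {x y : ℝ}
    (hx : x ∈ S.interval i) (hy : y ∈ S.interval i') :
    min 1 c.κ ^ l.length * c.g ≤ |S.wordMap i l x - S.wordMap i' l' y| := by
  have hg := c.g_pos
  have hκ := c.κ_pos
  have hm0 : 0 < min 1 c.κ := lt_min one_pos hκ
  have hm1 : min 1 c.κ ≤ 1 := min_le_left _ _
  induction l generalizing i i' l' x y with
  | nil =>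
    obtain rfl : l' = [] := List.length_eq_zero_iff.1 hlen.symm
    simpa [wordMap] using c.gap_interval i i' (by simpa using hne) x hx y hy
  | cons j l ih =>
    obtain _ | ⟨j', l'⟩ := l'
    · simp at hlen
    have hlen' : l.length = l'.length := by simpa using hlen
    by_cases hjl : j ≠ j' ∨ l ≠ l'
    · refine le_trans ?_ (ih hlen' h.2 h'.2 hjl (φ_mem h.1 hx) (φ_mem h'.1 hy))
      rw [List.length_cons, pow_succ]
      gcongr
      exact mul_le_of_le_one_right (by positivity) hm1
    · push Not at hjl
      obtain ⟨rfl, rfl⟩ := hjl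
      have hii : i ≠ i' := by simpa using hne
      refine le_trans ?_ (c.le_abs_wordMap_sub h.2 (φ_mem h.1 hx) (φ_mem h'.1 hy))
      have h1 := c.gap_image i i' j h.1 h'.1 hii x hx y hy
      have h2 : min 1 c.κ ^ (j :: l).length ≤ c.κ ^ l.length := by
        rw [List.length_cons, pow_succ]
        refine (mul_le_of_le_one_right (by positivity) hm1).trans ?_
        gcongr
        exact min_le_right _ _
      gcongr

/-- A bound for the second coordinates of points pulled back from the zero section. -/
noncomputable def R : ℝ := c.θ * c.T₀ / (1 - c.θ)

theorem R_nonneg : 0 ≤ c.R :=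
  div_nonneg (mul_nonneg c.θ_pos.le c.T₀_nonneg) (sub_nonneg.2 c.θ_lt_one.le)

/-- One backward step sends the bound `R` to at most `θ * (R + T₀)`, so `[-R, R]` is preserved. -/
theorem θ_mul_R_add : c.θ * (c.R + c.T₀) = c.R := by
  have := (sub_pos.2 c.θ_lt_one).ne'
  unfold R
  field_simp
  ring

theorem abs_pull_zero_le {i : Fin N} {l : List (Fin N)} (h : S.IsPath i l) {x : ℝ}
    (hx : x ∈ S.interval i) : |S.pull τ i l x 0| ≤ c.R := by
  induction l generalizing i x with
  | nil => simpa [pull] using c.R_nonneg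
  | cons j l ih =>
    rw [← c.θ_mul_R_add]
    simp only [pull, abs_mul]
    have := c.θ_pos
    gcongr
    · exact c.dφ_le i j h.1 x hx
    · refine (abs_sub _ _).trans (add_le_add (ih h.2 (φ_mem h.1 hx)) ?_)
      exact c.dτ_le _ (interval_subset_I j (φ_mem h.1 hx))

theorem abs_pull_le {i : Fin N} {l : List (Fin N)} (h : S.IsPath i l) {x : ℝ}
    (hx : x ∈ S.interval i) (η : ℝ) : |S.pull τ i l x η| ≤ c.R + c.θ ^ l.length * |η| := by
  have h1 := S.pull_sub_pull τ i l x η 0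
  rw [sub_zero] at h1
  have h2 : S.pull τ i l x η = S.pull τ i l x 0 + S.wordDeriv i l x * η := by linarith
  rw [h2]
  refine (abs_add_le _ _).trans (add_le_add (c.abs_pull_zero_le h hx) ?_)
  rw [abs_mul]
  gcongr
  exact c.abs_wordDeriv_le h hx

/-- A Lipschitz constant for `x ↦ pull τ i l x 0`. -/
noncomputable def Λ : ℝ := (c.L * (c.R + c.T₀) + c.T₁) / (1 - c.θ)

theorem Λ_nonneg : 0 ≤ c.Λ :=
  div_nonneg (add_nonneg (mul_nonneg c.L_nonneg (add_nonneg c.R_nonneg c.T₀_nonneg))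
    c.T₁_nonneg) (sub_nonneg.2 c.θ_lt_one.le)

theorem θ_mul_Λ_add : c.L * (c.R + c.T₀) + c.T₁ + c.θ * c.Λ = c.Λ := by
  have := (sub_pos.2 c.θ_lt_one).ne'
  unfold Λ
  field_simp
  ring

theorem abs_pull_zero_sub_le {i : Fin N} {l : List (Fin N)} (h : S.IsPath i l) {x y : ℝ}
    (hx : x ∈ S.interval i) (hy : y ∈ S.interval i) :
    |S.pull τ i l x 0 - S.pull τ i l y 0| ≤ c.Λ * |x - y| := by
  induction l generalizing i x y with
  | nil => simpa [pull] using mul_nonneg c.Λ_nonneg (abs_nonneg _)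
  | cons j l ih =>
    have hx' := φ_mem h.1 hx
    have hy' := φ_mem h.1 hy
    simp only [pull]
    set u := S.pull τ j l (S.φ i j x) 0
    set v := S.pull τ j l (S.φ i j y) 0
    set a := derivWithin τ S.I (S.φ i j x)
    set b := derivWithin τ S.I (S.φ i j y)
    have hθ := c.θ_pos
    have hθ1 := c.θ_lt_one
    have hT := c.T₁_nonneg
    have hL := c.L_nonneg
    have hΛ := c.Λ_nonneg
    have h1 : |S.φ i j x - S.φ i j y| ≤ c.θ * |x - y| := c.abs_φ_sub_le h.1 hx hy
    have h2 : |u - v| ≤ c.Λ * (c.θ * |x - y|) :=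
      (ih h.2 hx' hy').trans (by gcongr)
    have h3 : |a - b| ≤ c.T₁ * (c.θ * |x - y|) :=
      (c.dτ_lip j _ hx' _ hy').trans (by gcongr)
    have h4 : |u - a| ≤ c.R + c.T₀ := (abs_sub _ _).trans
      (add_le_add (c.abs_pull_zero_le h.2 hx') (c.dτ_le _ (interval_subset_I j hx')))
    have h5 := c.dφ_lip i j h.1 x hx y hy
    have h6 := c.dφ_le i j h.1 y hy
    -- The difference of products is split so that the variation of `dφ` meets the bounded factor `u
    -- - a`, and the recursive variation is multiplied by a derivative of size at most `θ`.
    calc |S.dφ i j x * (u - a) - S.dφ i j y * (v - b)|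
        = |(S.dφ i j x - S.dφ i j y) * (u - a) + S.dφ i j y * ((u - v) - (a - b))| := by
          congr 1; ring
      _ ≤ |S.dφ i j x - S.dφ i j y| * |u - a| + |S.dφ i j y| * (|u - v| + |a - b|) := by
          refine (abs_add_le _ _).trans ?_
          rw [abs_mul, abs_mul]
          gcongr
          exact abs_sub _ _
      _ ≤ c.L * |x - y| * (c.R + c.T₀) +
          c.θ * (c.Λ * (c.θ * |x - y|) + c.T₁ * (c.θ * |x - y|)) := by gcongr
      _ ≤ c.L * |x - y| * (c.R + c.T₀) + (c.θ * (c.Λ * |x - y|) + c.T₁ * |x - y|) := by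
          have e1 : c.θ * (c.Λ * (c.θ * |x - y|)) ≤ c.θ * (c.Λ * |x - y|) := by
            gcongr
            exact mul_le_of_le_one_left (abs_nonneg _) hθ1.le
          have e2 : c.θ * (c.T₁ * (c.θ * |x - y|)) ≤ c.T₁ * |x - y| := by
            have : c.θ * c.θ ≤ 1 := mul_le_one₀ hθ1.le hθ.le hθ1.le
            calc _ = (c.θ * c.θ) * (c.T₁ * |x - y|) := by ring
              _ ≤ 1 * (c.T₁ * |x - y|) := by gcongr
              _ = _ := one_mul _
          linarith
      _ = (c.L * (c.R + c.T₀) + c.T₁ + c.θ * c.Λ) * |x - y| := by ring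
      _ = _ := by rw [c.θ_mul_Λ_add]

end Constants

end IteratedFunctionScheme

-- Trapped sets in position and phase space.

namespace IteratedFunctionScheme

section Trapped

variable {N : ℕ} {S : IteratedFunctionScheme N}

theorem Kn_succ (n : ℕ) : S.Kn (n + 1) = S.image (S.Kn n) :=
  Function.iterate_succ_apply' _ _ _

theorem image_subset_I (s : Set ℝ) : S.image s ⊆ S.I := by
  rintro _ ⟨i, j, h, x, hx, rfl⟩
  exact interval_subset_I j (φ_mem h hx.2)

theorem image_mono {s t : Set ℝ} (h : s ⊆ t) : S.image s ⊆ S.image t := by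
  rintro _ ⟨i, j, hij, x, hx, rfl⟩
  exact ⟨i, j, hij, x, ⟨h hx.1, hx.2⟩, rfl⟩

theorem Kn_succ_subset (n : ℕ) : S.Kn (n + 1) ⊆ S.Kn n := by
  induction n with
  | zero => rw [Kn_succ]; exact image_subset_I _
  | succ n ih => exact (Kn_succ (n + 1)).le.trans ((image_mono ih).trans (Kn_succ n).ge)

theorem Kn_antitone : Antitone S.Kn := antitone_nat_of_succ_le Kn_succ_subset

theorem K_subset_I : S.K ⊆ S.I := iInter_subset _ 0

theorem wordMap_mem_Kn {i : Fin N} {l : List (Fin N)} (h : S.IsPath i l) {x : ℝ} {m : ℕ}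
    (hx : x ∈ S.interval i) (hm : x ∈ S.Kn m) : S.wordMap i l x ∈ S.Kn (m + l.length) := by
  induction l generalizing i x m with
  | nil => exact hm
  | cons j l ih =>
    have := ih h.2 (φ_mem h.1 hx) (m := m + 1) (by
      rw [Kn_succ]; exact ⟨i, j, h.1, x, ⟨hm, hx⟩, rfl⟩)
    rwa [List.length_cons, show m + (l.length + 1) = m + 1 + l.length by ring]

theorem wordMap_mem_K {i : Fin N} {l : List (Fin N)} (h : S.IsPath i l) {x : ℝ}
    (hx : x ∈ S.interval i) (hK : x ∈ S.K) : S.wordMap i l x ∈ S.K :=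
  mem_iInter.2 fun m => Kn_antitone (Nat.le_add_right _ _)
    (wordMap_mem_Kn h hx (mem_iInter.1 hK m))

/-- Separation and injectivity make the preimage unique, so the same `y` witnesses membership at
every level `n`. -/
theorem exists_preimage_mem_K {x : ℝ} (hx : x ∈ S.K) :
    ∃ i j, S.A i j = 1 ∧ ∃ y ∈ S.K ∩ S.interval i, S.φ i j y = x := by
  have hn : ∀ n, x ∈ S.image (S.Kn n) := fun n => by rw [← Kn_succ]; exact mem_iInter.1 hx _
  obtain ⟨i, j, hij, y, hy, hyx⟩ := hn 0
  refine ⟨i, j, hij, y, ⟨mem_iInter.2 fun n => ?_, hy.2⟩, hyx⟩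
  obtain ⟨k, l, hkl, z, hz, hzx⟩ := hn n
  obtain ⟨rfl, rfl⟩ := S.separation i j k l hij hkl
    ⟨x, ⟨y, hy.2, hyx⟩, ⟨z, hz.2, hzx⟩⟩
  rw [S.φ_injOn _ _ hij hy.2 hz.2 (hyx.trans hzx.symm)]
  exact hz.1

theorem exists_word_of_mem_K {x : ℝ} (hx : x ∈ S.K) (n : ℕ) :
    ∃ i l, l.length = n ∧ S.IsPath i l ∧ ∃ y ∈ S.K ∩ S.interval i, S.wordMap i l y = x := by
  induction n with
  | zero =>
    obtain ⟨i, hi⟩ := mem_iUnion.1 (K_subset_I hx)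
    exact ⟨i, [], rfl, trivial, x, ⟨hx, hi⟩, rfl⟩
  | succ n ih =>
    obtain ⟨i, l, hl, hp, y, hy, rfl⟩ := ih
    obtain ⟨k, j, hkj, z, hz, rfl⟩ := exists_preimage_mem_K hy.1
    obtain rfl := eq_of_mem_interval hy.2 (φ_mem hkj hz.2)
    exact ⟨k, i :: l, by simp [hl], ⟨hkj, hp⟩, z, hz, rfl⟩

/-- By symmetry, the edge along which `x` was reached can be reversed. -/
theorem exists_successor (hA : S.A.IsSymm) {i : Fin N} {x : ℝ} (hx : x ∈ S.K)
    (hi : x ∈ S.interval i) : ∃ j, S.A i j = 1 := by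
  obtain ⟨k, j, hkj, z, hz, rfl⟩ := exists_preimage_mem_K hx
  obtain rfl := eq_of_mem_interval hi (φ_mem hkj hz.2)
  exact ⟨k, (hA.apply k i).trans hkj⟩

variable {τ : ℝ → ℝ}

theorem mem_canonicalMap_iff {p q : ℝ × ℝ} : q ∈ S.canonicalMap τ p ↔ ∃ i j, S.A i j = 1 ∧
    p.1 ∈ S.interval i ∧ q.1 = S.φ i j p.1 ∧
      p.2 = S.dφ i j p.1 * (q.2 - derivWithin τ S.I (S.φ i j p.1)) := by
  unfold canonicalMap
  simp only [mem_ofPred_eq]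
  refine exists_congr fun i => exists_congr fun j => and_congr_right fun h =>
    and_congr_right fun hp => ?_
  have hne : S.dφ i j p.1 ≠ 0 := dφ_ne_zero h hp
  rw [Prod.ext_iff]
  refine and_congr_right fun _ => ?_
  change q.2 = (S.dφ i j p.1)⁻¹ * p.2 + derivWithin τ S.I (S.φ i j p.1) ↔ _
  constructor
  · intro h'; rw [h']; field_simp; ring
  · intro h'; rw [h']; field_simp; ring

theorem mem_iterate_canonicalImage_iff {p q : ℝ × ℝ} (hp : p.1 ∈ S.I) {n : ℕ} :
    q ∈ (S.canonicalImage τ)^[n] {p} ↔ ∃ i l, l.length = n ∧ S.IsPath i l ∧ p.1 ∈ S.interval i ∧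
      q.1 = S.wordMap i l p.1 ∧ p.2 = S.pull τ i l p.1 q.2 := by
  induction n generalizing q with
  | zero =>
    simp only [Function.iterate_zero, id_eq, mem_singleton_iff]
    constructor
    · rintro rfl
      obtain ⟨i, hi⟩ := mem_iUnion.1 hp
      exact ⟨i, [], rfl, trivial, hi, rfl, rfl⟩
    · rintro ⟨i, l, hl, -, -, h1, h2⟩
      obtain rfl := List.length_eq_zero_iff.1 hl
      exact Prod.ext h1 h2.symm
  | succ n ih =>
    rw [Function.iterate_succ_apply']
    unfold canonicalImage at ih ⊢
    simp only [mem_iUnion, exists_prop]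
    constructor
    · rintro ⟨q', hq', hq⟩
      obtain ⟨i, l, hl, hpath, hi, h1, h2⟩ := ih.1 hq'
      obtain ⟨k, j, hkj, hk, h3, h4⟩ := mem_canonicalMap_iff.1 hq
      obtain rfl : k = endpoint i l :=
        eq_of_mem_interval hk (by rw [h1]; exact wordMap_mem hpath hi)
      refine ⟨i, l ++ [j], by simp [hl], isPath_append.2 ⟨hpath, hkj, trivial⟩, hi, ?_, ?_⟩
      · rw [wordMap_append, h3, h1]; rfl
      · rw [pull_append, h2, h4, h1]; rfl
    · rintro ⟨i, l', hl', hpath, hi, h1, h2⟩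
      obtain rfl | ⟨l, j, rfl⟩ := List.eq_nil_or_concat l'
      · simp at hl'
      rw [List.concat_eq_append] at *
      rw [isPath_append] at hpath
      rw [wordMap_append] at h1
      rw [pull_append] at h2
      refine ⟨(S.wordMap i l p.1, S.pull τ (endpoint i l) [j] (S.wordMap i l p.1) q.2),
        ih.2 ⟨i, l, by simpa using hl', hpath.1, hi, rfl, h2⟩, mem_canonicalMap_iff.2
        ⟨endpoint i l, j, hpath.2.1, wordMap_mem hpath.1 hi, h1, rfl⟩⟩

/-- Negative times constrain only `x`, forcing it into `K`: backward branches contract the fibre, so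
backward orbits stay bounded automatically. Positive times give, for each length, a path whose
terminal fibre coordinate is bounded independently of the length. -/
theorem mem_phaseTrapped_iff (c : S.Constants τ) {p : ℝ × ℝ} : p ∈ S.phaseTrapped τ ↔
    p.1 ∈ S.K ∧ ∃ M, ∀ n, ∃ i l η, l.length = n ∧ S.IsPath i l ∧ p.1 ∈ S.interval i ∧
      |η| ≤ M ∧ p.2 = S.pull τ i l p.1 η := by
  constructor
  · rintro ⟨hp, C, hC, hcomp, h⟩
    have hpI : p.1 ∈ S.I := hp.1
    obtain ⟨M, hM⟩ := hcomp.isBounded.exists_norm_le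
    refine ⟨mem_iInter.2 fun n => ?_, M, fun n => ?_⟩
    · cases n with
      | zero => exact hpI
      | succ n =>
        obtain ⟨q, hq, hqC⟩ := h (Int.negSucc n)
        obtain ⟨i, l, hl, hpath, hi, h1, -⟩ :=
          (mem_iterate_canonicalImage_iff (hC hqC).1).1 (show p ∈ _ from hq)
        rw [h1, ← hl, ← Nat.zero_add l.length]
        exact wordMap_mem_Kn hpath hi (interval_subset_I i hi)
    · obtain ⟨q, hq, hqC⟩ := h (Int.ofNat n)
      obtain ⟨i, l, hl, hpath, hi, -, h2⟩ := (mem_iterate_canonicalImage_iff hpI).1 hq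
      exact ⟨i, l, q.2, hl, hpath, hi, (norm_snd_le q).trans (hM q hqC), h2⟩
  · rintro ⟨hK, M, h⟩
    have hpI := K_subset_I hK
    -- `|M|` takes care of forward times and `R + |p.2|` of backward times.
    refine ⟨⟨hpI, trivial⟩, S.I ×ˢ Icc (-(|M| + c.R + |p.2|)) (|M| + c.R + |p.2|),
      prod_mono le_rfl (subset_univ _), isCompact_I.prod isCompact_Icc, fun n => ?_⟩
    have hR := c.R_nonneg
    have hM := abs_nonneg M
    have hp2 := abs_nonneg p.2
    obtain n | n := n
    · obtain ⟨i, l, η, hl, hpath, hi, hη, h2⟩ := h n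
      refine ⟨(S.wordMap i l p.1, η), (mem_iterate_canonicalImage_iff hpI).2
        ⟨i, l, hl, hpath, hi, rfl, h2⟩, interval_subset_I _ (wordMap_mem hpath hi), ?_⟩
      rw [mem_Icc, ← abs_le]
      linarith [le_abs_self M]
    · obtain ⟨i, l, hl, hpath, y, hy, hyp⟩ := exists_word_of_mem_K hK (n + 1)
      refine ⟨(y, S.pull τ i l y p.2), (mem_iterate_canonicalImage_iff (K_subset_I hy.1)).2
        ⟨i, l, hl, hpath, hy.2, hyp.symm, rfl⟩, K_subset_I hy.1, ?_⟩
      rw [mem_Icc, ← abs_le]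
      have h1 := c.abs_pull_le hpath hy.2 p.2
      have h2 : c.θ ^ l.length * |p.2| ≤ |p.2| :=
        mul_le_of_le_one_left hp2 (pow_le_one₀ c.θ_pos.le c.θ_lt_one.le)
      simp only
      linarith

theorem pull_mem_phaseTrapped (c : S.Constants τ) {i : Fin N} {l : List (Fin N)}
    (h : S.IsPath i l) {x η : ℝ} (hx : x ∈ S.interval i) (hK : x ∈ S.K)
    (hη : (S.wordMap i l x, η) ∈ S.phaseTrapped τ) :
    (x, S.pull τ i l x η) ∈ S.phaseTrapped τ := by
  induction l generalizing i x with
  | nil => exact hη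
  | cons j l ih =>
    have h1 := ih h.2 (φ_mem h.1 hx) (wordMap_mem_K (l := [j]) ⟨h.1, trivial⟩ hx hK) hη
    rw [mem_phaseTrapped_iff c] at h1 ⊢
    obtain ⟨-, M, hM⟩ := h1
    -- The length-zero path has the fibre coordinate itself as terminal value, so the bound is
    -- enlarged to include it.
    refine ⟨hK, max M |S.pull τ i (j :: l) x η|, fun n => ?_⟩
    cases n with
    | zero => exact ⟨i, [], _, rfl, trivial, hx, le_max_right _ _, rfl⟩
    | succ n =>
      obtain ⟨k, l', η', hl', hpath, hk, hη', he⟩ := hM n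
      obtain rfl := eq_of_mem_interval (φ_mem h.1 hx) hk
      refine ⟨i, j :: l', η', by simp [hl'], ⟨h.1, hpath⟩, hx, hη'.trans (le_max_left _ _), ?_⟩
      simp only [pull] at he ⊢
      rw [he]

/-- The path of length `n` alternating between `j` and `i`. -/
def alternating : Fin N → Fin N → ℕ → List (Fin N)
  | _, _, 0 => []
  | i, j, n + 1 => j :: alternating j i n

theorem length_alternating (i j : Fin N) (n : ℕ) : (alternating i j n).length = n := by
  induction n generalizing i j with
  | zero => rfl
  | succ n ih => simp [alternating, ih]

theorem isPath_alternating (hA : S.A.IsSymm) {i j : Fin N} (h : S.A i j = 1) (n : ℕ) :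
    S.IsPath i (alternating i j n) := by
  induction n generalizing i j with
  | zero => trivial
  | succ n ih => exact ⟨h, ih ((hA.apply i j).trans h)⟩

/-- The last letter of the longer path maps `[-R, R]` into itself before the shorter path acts. -/
theorem pull_alternating_subset (c : S.Constants τ) (hA : S.A.IsSymm) {i j : Fin N}
    (h : S.A i j = 1) {x : ℝ} (hx : x ∈ S.interval i) (n : ℕ) :
    S.pull τ i (alternating i j (n + 1)) x '' Icc (-c.R) c.R ⊆
      S.pull τ i (alternating i j n) x '' Icc (-c.R) c.R := by
  induction n generalizing i j x with
  | zero =>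
    rintro _ ⟨η, hη, rfl⟩
    refine ⟨_, ?_, rfl⟩
    rw [mem_Icc, ← abs_le] at hη ⊢
    rw [← c.θ_mul_R_add]
    simp only [alternating, pull, abs_mul]
    have hθ := c.θ_pos
    have hx' := φ_mem h hx
    gcongr
    · exact c.dφ_le i j h x hx
    · exact (abs_sub _ _).trans (add_le_add hη (c.dτ_le _ (interval_subset_I j hx')))
  | succ n ih =>
    rintro _ ⟨η, hη, rfl⟩
    obtain ⟨η', hη', he⟩ := ih ((hA.apply i j).trans h) (φ_mem h hx)
      (mem_image_of_mem _ hη)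
    refine ⟨η', hη', ?_⟩
    rw [alternating, alternating]
    simp only [pull]
    rw [he]

/-- Symmetry allows an endless walk back and forth along one edge. A point in the intersection of
the nested compact pull-backs of `[-R, R]` has a bounded future along it. -/
theorem exists_mem_phaseTrapped (c : S.Constants τ) (hA : S.A.IsSymm) {x : ℝ} (hx : x ∈ S.K) :
    ∃ ξ, (x, ξ) ∈ S.phaseTrapped τ := by
  obtain ⟨i, hi⟩ := mem_iUnion.1 (K_subset_I hx)
  obtain ⟨j, hij⟩ := exists_successor hA hx hi
  have hcont : ∀ n, Continuous (S.pull τ i (alternating i j n) x) := fun n => by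
    have : S.pull τ i (alternating i j n) x = fun η => S.pull τ i (alternating i j n) x 0 +
        S.wordDeriv i (alternating i j n) x * (η - 0) := by
      funext η
      rw [← pull_sub_pull τ]; ring
    rw [this]
    fun_prop
  have hcomp : ∀ n, IsCompact (S.pull τ i (alternating i j n) x '' Icc (-c.R) c.R) := fun n =>
    isCompact_Icc.image (hcont n)
  obtain ⟨ξ, hξ⟩ := IsCompact.nonempty_iInter_of_sequence_nonempty_isCompact_isClosed
    (fun n => S.pull τ i (alternating i j n) x '' Icc (-c.R) c.R)
    (fun n => pull_alternating_subset c hA hij hi n)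
    (fun n => (nonempty_Icc.2 (by linarith [c.R_nonneg])).image _) (hcomp 0)
    (fun n => (hcomp n).isClosed)
  refine ⟨ξ, (mem_phaseTrapped_iff c).2 ⟨hx, c.R, fun n => ?_⟩⟩
  obtain ⟨η, hη, he⟩ := mem_iInter.1 hξ n
  exact ⟨i, alternating i j n, η, length_alternating i j n, isPath_alternating hA hij n, hi,
    abs_le.2 hη, he.symm⟩

theorem mem_phaseTrappedNhd_of_mem {p : ℝ × ℝ} {ε : ℝ} (hε : 0 ≤ ε) (hp : p ∈ S.phaseTrapped τ) :
    p ∈ S.phaseTrappedNhd τ ε :=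
  ⟨hp.1, p, hp, by simpa using hε⟩

/-- Minimal captivity separates the points of a fibre of the trapped set whose trajectories follow
different paths. -/
theorem MinimallyCaptive.exists_fiber_gap (hcap : S.MinimallyCaptive τ) (c : S.Constants τ)
    (n : ℕ) : ∃ σ, 0 < σ ∧ ∀ i l l', l.length = n → l'.length = n → l ≠ l' → S.IsPath i l →
      S.IsPath i l' → ∀ x ∈ S.interval i, x ∈ S.K → ∀ η η',
      (S.wordMap i l x, η) ∈ S.phaseTrapped τ → (S.wordMap i l' x, η') ∈ S.phaseTrapped τ →
      σ ≤ |S.pull τ i l x η - S.pull τ i l' x η'| := by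
  have hκ := c.κ_pos
  induction n with
  | zero =>
    refine ⟨1, one_pos, fun i l l' hl hl' hne => (hne ?_).elim⟩
    rw [List.length_eq_zero_iff.1 hl, List.length_eq_zero_iff.1 hl']
  | succ n ih =>
    obtain ⟨σ, hσ, ih⟩ := ih
    obtain ⟨ε, hε, hcap⟩ := hcap
    refine ⟨min (c.κ * σ) (c.κ * ε), by positivity, ?_⟩
    rintro i (_ | ⟨j, l⟩) (_ | ⟨j', l'⟩) hl hl' hne h h' x hx hK η η' hη hη'
    · simp at hl
    · simp at hl
    · simp at hl'
    have hφK : ∀ k, S.A i k = 1 → S.φ i k x ∈ S.K := fun k hk =>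
      wordMap_mem_K (l := [k]) ⟨hk, trivial⟩ hx hK
    by_cases hj : j = j'
    · subst hj
      refine (min_le_left _ _).trans ?_
      have := ih j l l' (by simpa using hl) (by simpa using hl') (by simpa using hne) h.2 h'.2
        _ (φ_mem h.1 hx) (hφK j h.1) η η' hη hη'
      simp only [pull]
      rw [← mul_sub, abs_mul, sub_sub_sub_cancel_right]
      gcongr
      exact c.le_dφ i j h.1 x hx
    · refine (min_le_right _ _).trans ?_
      by_contra! hlt
      have hp := pull_mem_phaseTrapped c h hx hK hη
      have hq := pull_mem_phaseTrapped c h.2 (φ_mem h.1 hx) (hφK j h.1) hη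
      have hq' := pull_mem_phaseTrapped c h'.2 (φ_mem h'.1 hx) (hφK j' h'.1) hη'
      set ξ := S.pull τ i (j :: l) x η with hξ
      set ξ' := S.pull τ i (j' :: l') x η' with hξ'
      have hd : S.dφ i j' x ≠ 0 := dφ_ne_zero h'.1 hx
      have hq₁ : (S.φ i j x, S.pull τ j l (S.φ i j x) η) ∈ S.canonicalMap τ (x, ξ) ∩
          S.phaseTrappedNhd τ ε :=
        ⟨mem_canonicalMap_iff.2 ⟨i, j, h.1, hx, rfl, rfl⟩, mem_phaseTrappedNhd_of_mem hε.le hq⟩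
      -- The branch to `j'` sends `(x, ξ')` into the trapped set and expands the fibre by at most `1
      -- / κ`. As `|ξ - ξ'| < κ * ε`, the image of `(x, ξ)` is within `ε` of it, and minimal
      -- captivity forbids this second image.
      have hq₂ : (S.φ i j' x, (S.dφ i j' x)⁻¹ * ξ + derivWithin τ S.I (S.φ i j' x)) ∈
          S.canonicalMap τ (x, ξ) ∩ S.phaseTrappedNhd τ ε := by
        refine ⟨⟨i, j', h'.1, hx, rfl⟩, ⟨interval_subset_I j' (φ_mem h'.1 hx), trivial⟩,
          (S.φ i j' x, S.pull τ j' l' (S.φ i j' x) η'), hq', ?_⟩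
        have he : (S.dφ i j' x)⁻¹ * ξ + derivWithin τ S.I (S.φ i j' x) -
            S.pull τ j' l' (S.φ i j' x) η' = (S.dφ i j' x)⁻¹ * (ξ - ξ') := by
          rw [hξ']
          simp only [pull]
          field_simp
          ring
        simp only [sub_self, abs_zero]
        refine max_le hε.le ?_
        rw [he, abs_mul, abs_inv, inv_mul_le_iff₀ (abs_pos.2 hd)]
        refine hlt.le.trans ?_
        gcongr
        exact c.le_dφ i j' h'.1 x hx
      have heq := Set.encard_le_one_iff.1
        (hcap (x, ξ) (mem_phaseTrappedNhd_of_mem hε.le hp)) _ _ hq₁ hq₂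
      have hfst : S.φ i j x = S.φ i j' x := congrArg Prod.fst heq
      exact hj (S.separation i j i j' h.1 h'.1 ⟨S.φ i j x, ⟨x, hx, rfl⟩, ⟨x, hx, hfst.symm⟩⟩).2

end Trapped

end IteratedFunctionScheme

-- Coded limit sets of separated contractions.

section Coding

/-- The `m`-th approximation of the point with code `u`. -/
def codeApprox {M : ℕ} (f : Fin M → ℝ → ℝ) (x₀ : ℝ) : ℕ → (ℕ → Fin M) → ℝ
  | 0, _ => x₀
  | m + 1, u => f (u 0) (codeApprox f x₀ m fun k => u (k + 1))

/-- The limit set of a finite family of contractions of a compact set of reals with separated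
images contains a coded subset whose dimension is bounded below by the contraction rate. -/
theorem le_dimH_of_separated_contractions {M : ℕ} {f : Fin M → ℝ → ℝ} {J K : Set ℝ}
    {θ r g t : ℝ} (hJ : IsCompact J) (hne : J.Nonempty) (hmaps : ∀ a, ∀ x ∈ J, f a x ∈ J)
    (hθ0 : 0 ≤ θ) (hθ1 : θ < 1)
    (hcontr : ∀ a, ∀ x ∈ J, ∀ y ∈ J, |f a x - f a y| ≤ θ * |x - y|)
    (hr : 0 < r) (hr1 : r < 1) (hlow : ∀ a, ∀ x ∈ J, ∀ y ∈ J, r * |x - y| ≤ |f a x - f a y|)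
    (hg : 0 < g) (hgap : ∀ a b, a ≠ b → ∀ x ∈ J, ∀ y ∈ J, g ≤ |f a x - f b y|)
    (ht : 0 < t) (hM : r ^ (-t) ≤ M)
    (hK : ∀ E ⊆ J, (∀ x ∈ E, ∃ a, ∃ y ∈ E, f a y = x) → E ⊆ K) :
    ENNReal.ofReal t ≤ dimH K := by
  have hMpos : (0 : ℝ) < M := (Real.rpow_pos_of_pos hr _).trans_le hM
  have : NeZero M := ⟨by rintro rfl; simp at hMpos⟩
  obtain ⟨x₀, hx₀⟩ := hne
  obtain ⟨D, hD⟩ := hJ.isBounded.exists_norm_le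
  have hX : ∀ m u, codeApprox f x₀ m u ∈ J := by
    intro m
    induction m with
    | zero => exact fun _ => hx₀
    | succ m ih => exact fun u => hmaps _ _ (ih _)
  have hstep : ∀ m u, |codeApprox f x₀ m u - codeApprox f x₀ (m + 1) u| ≤ (2 * D) * θ ^ m := by
    intro m
    induction m with
    | zero =>
      intro u
      have h1 := hD _ (hX 0 u)
      have h2 := hD _ (hX 1 u)
      rw [Real.norm_eq_abs] at h1 h2
      calc _ ≤ _ := abs_sub _ _
        _ ≤ D + D := add_le_add h1 h2
        _ = _ := by ring
    | succ m ih =>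
      intro u
      calc _ ≤ θ * |codeApprox f x₀ m (fun k => u (k + 1)) -
            codeApprox f x₀ (m + 1) fun k => u (k + 1)| := hcontr _ _ (hX _ _) _ (hX _ _)
        _ ≤ θ * (2 * D * θ ^ m) := by gcongr; exact ih _
        _ = _ := by ring
  have hlim : ∀ u, ∃ x, Tendsto (fun m => codeApprox f x₀ m u) atTop (𝓝 x) := fun u =>
    cauchySeq_tendsto_of_complete (cauchySeq_of_le_geometric θ (2 * D) hθ1 fun m => hstep m u)
  choose π hπ using hlim
  have hπJ : ∀ u, π u ∈ J := fun u =>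
    hJ.isClosed.mem_of_tendsto (hπ u) (Eventually.of_forall fun m => hX m u)
  have hπf : ∀ u, π u = f (u 0) (π fun k => u (k + 1)) := by
    intro u
    refine tendsto_nhds_unique ((tendsto_add_atTop_iff_nat 1).2 (hπ u)) ?_
    rw [tendsto_iff_dist_tendsto_zero]
    have h0 := (tendsto_iff_dist_tendsto_zero.1 (hπ fun k => u (k + 1))).const_mul θ
    rw [mul_zero] at h0
    exact squeeze_zero (fun _ => dist_nonneg) (fun m => hcontr _ _ (hX _ _) _ (hπJ _)) h0
  have hsep : ∀ k u v, (∀ j < k, u j = v j) → u k ≠ v k → r ^ k * g ≤ |π u - π v| := by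
    intro k
    induction k with
    | zero =>
      intro u v _ huv
      rw [hπf u, hπf v, pow_zero, one_mul]
      exact hgap _ _ huv _ (hπJ _) _ (hπJ _)
    | succ k ih =>
      intro u v hj huv
      have h1 := ih (fun k => u (k + 1)) (fun k => v (k + 1)) (fun j hjk => hj _ (by omega)) huv
      rw [hπf u, hπf v, hj 0 (by omega)]
      refine le_trans ?_ (hlow _ _ (hπJ _) _ (hπJ _))
      rw [pow_succ', mul_assoc]
      gcongr
  have hfirst : ∀ u v : ℕ → Fin M, u ≠ v → ∃ k, (∀ j < k, u j = v j) ∧ u k ≠ v k := by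
    intro u v huv
    have hex : ∃ k, u k ≠ v k := Function.ne_iff.1 huv
    classical
    exact ⟨Nat.find hex, fun j hj => not_not.1 (Nat.find_min hex hj), Nat.find_spec hex⟩
  have hinj : Function.Injective π := by
    intro u v huv
    by_contra hne
    obtain ⟨k, h1, h2⟩ := hfirst u v hne
    have := hsep k u v h1 h2
    rw [huv, sub_self, abs_zero] at this
    exact absurd this (not_le.2 (by positivity))
  have : Nonempty (ℕ → Fin M) := ⟨fun _ => 0⟩
  -- The code of a point is read as a base `M` expansion. Codes agreeing exactly to depth `k` give
  -- numbers within `M ^ (-k) ≤ r ^ (k * t)` and points at least `r ^ k * g` apart, so `G` is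
  -- `t`-Hölder. Its image contains `[0, 1)`, of dimension `1`.
  set G : ℝ → ℝ := fun y => Real.ofDigits (Function.invFun π y) with hG
  have hGπ : ∀ u, G (π u) = Real.ofDigits u := fun u => by
    rw [hG]; simp only [Function.leftInverse_invFun hinj u]
  have hhol : HolderOnWith (g ^ (-t)).toNNReal t.toNNReal G (range π) := by
    rintro _ ⟨u, rfl⟩ _ ⟨v, rfl⟩
    rw [hGπ, hGπ]
    by_cases huv : u = v
    · subst huv; simp
    obtain ⟨k, h1, h2⟩ := hfirst u v huv
    have hd := hsep k u v h1 h2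
    have hreal : dist (Real.ofDigits u) (Real.ofDigits v) ≤ g ^ (-t) * dist (π u) (π v) ^ t := by
      rw [Real.dist_eq, Real.dist_eq]
      calc |Real.ofDigits u - Real.ofDigits v| ≤ ((M : ℝ) ^ k)⁻¹ :=
            Real.abs_ofDigits_sub_ofDigits_le h1
        _ ≤ ((r ^ (-t)) ^ k)⁻¹ := by gcongr
        _ = g ^ (-t) * (r ^ k * g) ^ t := by
            rw [Real.mul_rpow (by positivity) hg.le, ← Real.rpow_natCast, ← Real.rpow_mul hr.le,
              ← Real.rpow_neg hr.le, ← Real.rpow_natCast r k, ← Real.rpow_mul hr.le,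
              Real.rpow_neg hg.le]
            have : g ^ t ≠ 0 := (Real.rpow_pos_of_pos hg t).ne'
            field_simp
        _ ≤ g ^ (-t) * |π u - π v| ^ t := by gcongr
    rw [edist_dist, edist_dist, Real.coe_toNNReal t ht.le,
      ENNReal.ofReal_rpow_of_nonneg dist_nonneg ht.le]
    change _ ≤ ENNReal.ofReal _ * _
    rw [← ENNReal.ofReal_mul (by positivity)]
    exact ENNReal.ofReal_le_ofReal hreal
  have himg : Ico (0 : ℝ) 1 ⊆ G '' range π := by
    intro y hy
    have hM1 : 1 < M := by
      exact_mod_cast (Real.one_lt_rpow_of_pos_of_lt_one_of_neg hr hr1 (neg_lt_zero.2 ht)).trans_le hM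
    exact ⟨π (Real.digits y M), ⟨_, rfl⟩, by rw [hGπ]; exact Real.ofDigits_digits hM1 hy⟩
  have hdim := hhol.dimH_image_le (Real.toNNReal_pos.2 ht)
  have h1 : (1 : ℝ≥0∞) ≤ dimH (G '' range π) := by
    refine le_trans (le_of_eq ?_) (dimH_mono himg)
    rw [Real.dimH_of_nonempty_interior (E := ℝ) (by simp)]
    simp
  have h2 := (ENNReal.le_div_iff_mul_le (Or.inl (by simpa using ht))
    (Or.inl ENNReal.coe_ne_top)).1 (h1.trans hdim)
  rw [one_mul] at h2
  refine h2.trans (dimH_mono (hK _ (range_subset_iff.2 hπJ) ?_))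
  rintro _ ⟨u, rfl⟩
  exact ⟨u 0, _, ⟨_, rfl⟩, (hπf u).symm⟩

/-- Distinct words of the same length send a point to separated points. -/
theorem foldr_separated {α : Type*} {f : α → ℝ → ℝ} {J : Set ℝ} {r g : ℝ}
    (hmaps : ∀ a, ∀ x ∈ J, f a x ∈ J) (hr : 0 < r) (hr1 : r ≤ 1)
    (hlow : ∀ a, ∀ x ∈ J, ∀ y ∈ J, r * |x - y| ≤ |f a x - f a y|)
    (hg : 0 < g) (hgap : ∀ a b, a ≠ b → ∀ x ∈ J, ∀ y ∈ J, g ≤ |f a x - f b y|) {x : ℝ}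
    (hx : x ∈ J) {u v : List α} (hlen : u.length = v.length) (huv : u ≠ v) :
    r ^ u.length * g ≤ |u.foldr f x - v.foldr f x| := by
  have hJ : ∀ u : List α, u.foldr f x ∈ J := by
    intro u
    induction u with
    | nil => exact hx
    | cons a u ih => exact hmaps _ _ ih
  induction u generalizing v with
  | nil => exact (huv (List.length_eq_zero_iff.1 hlen.symm).symm).elim
  | cons a u ih =>
    obtain _ | ⟨b, v⟩ := v
    · simp at hlen
    simp only [List.foldr_cons]
    by_cases hab : a = b
    · subst hab
      refine le_trans ?_ (hlow _ _ (hJ _) _ (hJ _))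
      rw [List.length_cons, pow_succ', mul_assoc]
      gcongr
      exact ih (by simpa using hlen) (by simpa using huv)
    · refine le_trans ?_ (hgap _ _ hab _ (hJ _) _ (hJ _))
      exact mul_le_of_le_one_left hg.le (pow_le_one₀ hr.le hr1)

end Coding

-- Lower bounds from loops.

namespace IteratedFunctionScheme

variable {N : ℕ} {S : IteratedFunctionScheme N} {τ : ℝ → ℝ}

/-- There are at least `r ^ (-t)` loops of a common length at some vertex visited by `K`, all of
whose maps contract at most by the factor `r < 1`. -/
def HasLoops (S : IteratedFunctionScheme N) (t : ℝ) : Prop :=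
  ∃ i, (S.K ∩ S.interval i).Nonempty ∧ ∃ (n : ℕ) (r : ℝ), 0 < r ∧ r < 1 ∧
    ∃ W : Finset (List (Fin N)), r ^ (-t) ≤ W.card ∧ ∀ l ∈ W, l.length = n ∧ S.IsPath i l ∧
      endpoint i l = i ∧ ∀ x ∈ S.interval i, r ≤ |S.wordDeriv i l x| ∧
        ∀ y ∈ S.interval i, r * |x - y| ≤ |S.wordMap i l x - S.wordMap i l y|

/-- An enumerated family of loops as in `HasLoops`. -/
structure LoopFamily (S : IteratedFunctionScheme N) (t : ℝ) where
  i : Fin N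
  x₀ : ℝ
  n : ℕ
  r : ℝ
  M : ℕ
  e : Fin M → List (Fin N)
  x₀_mem_K : x₀ ∈ S.K
  x₀_mem : x₀ ∈ S.interval i
  n_pos : 0 < n
  r_pos : 0 < r
  r_lt_one : r < 1
  le_M : r ^ (-t) ≤ M
  e_injective : Function.Injective e
  length_e : ∀ a, (e a).length = n
  isPath : ∀ a, S.IsPath i (e a)
  endpoint_e : ∀ a, endpoint i (e a) = i
  le_wordDeriv : ∀ a, ∀ x ∈ S.interval i, r ≤ |S.wordDeriv i (e a) x|
  le_wordMap : ∀ a, ∀ x ∈ S.interval i, ∀ y ∈ S.interval i,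
    r * |x - y| ≤ |S.wordMap i (e a) x - S.wordMap i (e a) y|

theorem HasLoops.nonempty_loopFamily {t : ℝ} (ht : 0 < t) (h : S.HasLoops t) :
    Nonempty (S.LoopFamily t) := by
  obtain ⟨i, ⟨x₀, hK, hx₀⟩, n, r, hr, hr1, W, hW, hl⟩ := h
  -- Since `r ^ (-t) > 1` there is more than one loop, whereas only the empty word has length zero.
  -- Positive length is what makes the return maps strict contractions.
  have hn : 0 < n := by
    by_contra! hn
    have hsub : W ⊆ {[]} := fun l hlW => by
      have := (hl l hlW).1
      rw [Finset.mem_singleton, ← List.length_eq_zero_iff]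
      omega
    have h1 : (W.card : ℝ) ≤ 1 := by exact_mod_cast Finset.card_le_card hsub
    have h2 := Real.one_lt_rpow_of_pos_of_lt_one_of_neg hr hr1 (neg_lt_zero.2 ht)
    linarith
  let e : Fin W.card → List (Fin N) := fun a => (W.equivFin.symm a).1
  have he : ∀ a, e a ∈ W := fun a => (W.equivFin.symm a).2
  exact ⟨{
    i := i, x₀ := x₀, n := n, r := r, M := W.card, e := e
    x₀_mem_K := hK
    x₀_mem := hx₀
    n_pos := hn
    r_pos := hr
    r_lt_one := hr1
    le_M := hW
    e_injective := Subtype.val_injective.comp W.equivFin.symm.injective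
    length_e := fun a => (hl _ (he a)).1
    isPath := fun a => (hl _ (he a)).2.1
    endpoint_e := fun a => (hl _ (he a)).2.2.1
    le_wordDeriv := fun a x hx => ((hl _ (he a)).2.2.2 x hx).1
    le_wordMap := fun a x hx => ((hl _ (he a)).2.2.2 x hx).2 }⟩

namespace LoopFamily

variable {t : ℝ} (F : S.LoopFamily t)

/-- The first return map along the loop `e a`. -/
def map (a : Fin F.M) : ℝ → ℝ := S.wordMap F.i (F.e a)

theorem map_mem (a : Fin F.M) {x : ℝ} (hx : x ∈ S.interval F.i) : F.map a x ∈ S.interval F.i := by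
  have := wordMap_mem (F.isPath a) hx
  rwa [F.endpoint_e] at this

theorem map_mem_K (a : Fin F.M) {x : ℝ} (hx : x ∈ S.interval F.i) (hK : x ∈ S.K) :
    F.map a x ∈ S.K := wordMap_mem_K (F.isPath a) hx hK

theorem foldr_map_mem (u : List (Fin F.M)) :
    u.foldr F.map F.x₀ ∈ S.K ∩ S.interval F.i := by
  induction u with
  | nil => exact ⟨F.x₀_mem_K, F.x₀_mem⟩
  | cons a u ih => exact ⟨F.map_mem_K a ih.2 ih.1, F.map_mem a ih.2⟩

theorem exists_gap (c : S.Constants τ) : ∃ g, 0 < g ∧ ∀ a b, a ≠ b → ∀ x ∈ S.interval F.i,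
    ∀ y ∈ S.interval F.i, g ≤ |F.map a x - F.map b y| := by
  have := c.κ_pos
  have := c.g_pos
  refine ⟨min 1 c.κ ^ F.n * c.g, by positivity, fun a b hab x hx y hy => ?_⟩
  have := c.gap_wordMap ((F.length_e a).trans (F.length_e b).symm) (F.isPath a) (F.isPath b)
    (Or.inr (F.e_injective.ne hab)) hx hy
  rwa [F.length_e] at this

theorem le_dimH (F : S.LoopFamily t) (c : S.Constants τ) (ht : 0 < t) : ENNReal.ofReal t ≤ dimH S.K := by
  obtain ⟨g, hg, hgap⟩ := F.exists_gap c
  refine le_dimH_of_separated_contractions (f := F.map) (isCompact_interval F.i)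
    ⟨F.x₀, F.x₀_mem⟩ (fun a x hx => F.map_mem a hx) c.θ_pos.le c.θ_lt_one ?_ F.r_pos F.r_lt_one
    F.le_wordMap hg hgap ht F.le_M ?_
  · intro a x hx y hy
    have := c.abs_wordMap_sub_le_pow (F.isPath a) hx hy
    refine this.trans ?_
    gcongr
    exact pow_le_of_le_one c.θ_pos.le c.θ_lt_one.le (by rw [F.length_e]; exact F.n_pos.ne')
  · intro E hE hinv
    refine subset_iInter fun k => ?_
    induction k with
    | zero => exact hE.trans (interval_subset_I _)
    | succ k ih =>
      intro x hx
      obtain ⟨a, y, hy, rfl⟩ := hinv x hx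
      refine Kn_antitone ?_ (wordMap_mem_Kn (F.isPath a) (hE hy) (ih hy))
      rw [F.length_e]
      have := F.n_pos
      omega

/-- The second coordinate of the point of the phase space trapped set over `x` whose trajectory
follows the loops in `v`, and then continues as that of `(y, ζ y)`. -/
noncomputable def fiberPoint (τ ζ : ℝ → ℝ) : List (Fin F.M) → ℝ → ℝ
  | [], x => ζ x
  | a :: v, x => S.pull τ F.i (F.e a) x (fiberPoint τ ζ v (F.map a x))

theorem fiberPoint_mem (c : S.Constants τ) {ζ : ℝ → ℝ}
    (hζ : ∀ x ∈ S.K, (x, ζ x) ∈ S.phaseTrapped τ) (v : List (Fin F.M)) {x : ℝ}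
    (hx : x ∈ S.interval F.i) (hK : x ∈ S.K) : (x, F.fiberPoint τ ζ v x) ∈ S.phaseTrapped τ := by
  induction v generalizing x with
  | nil => exact hζ x hK
  | cons a v ih =>
    exact pull_mem_phaseTrapped c (F.isPath a) hx hK (ih (F.map_mem a hx) (F.map_mem_K a hx hK))

/-- The first differing loop produces the captivity gap `σ`, and each common loop before it shrinks
the gap by a factor no smaller than `r`. -/
theorem fiberPoint_separated (c : S.Constants τ) {ζ : ℝ → ℝ}
    (hζ : ∀ x ∈ S.K, (x, ζ x) ∈ S.phaseTrapped τ) {σ : ℝ} (hσ : 0 < σ)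
    (hgap : ∀ i l l', l.length = F.n → l'.length = F.n → l ≠ l' → S.IsPath i l →
      S.IsPath i l' → ∀ x ∈ S.interval i, x ∈ S.K → ∀ η η',
      (S.wordMap i l x, η) ∈ S.phaseTrapped τ → (S.wordMap i l' x, η') ∈ S.phaseTrapped τ →
      σ ≤ |S.pull τ i l x η - S.pull τ i l' x η'|) {u v : List (Fin F.M)}
    (hlen : u.length = v.length) (huv : u ≠ v) {x : ℝ} (hx : x ∈ S.interval F.i) (hK : x ∈ S.K) :
    F.r ^ u.length * σ ≤ |F.fiberPoint τ ζ u x - F.fiberPoint τ ζ v x| := by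
  have hr := F.r_pos
  induction u generalizing v x with
  | nil => exact (huv (List.length_eq_zero_iff.1 hlen.symm).symm).elim
  | cons a u ih =>
    obtain _ | ⟨b, v⟩ := v
    · simp at hlen
    simp only [fiberPoint]
    by_cases hab : a = b
    · subst hab
      rw [pull_sub_pull, abs_mul, List.length_cons, pow_succ', mul_assoc]
      gcongr
      · exact F.le_wordDeriv a x hx
      · exact ih (by simpa using hlen) (by simpa using huv) (F.map_mem a hx) (F.map_mem_K a hx hK)
    · refine le_trans ?_ (hgap F.i _ _ (F.length_e a) (F.length_e b) (F.e_injective.ne hab)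
        (F.isPath a) (F.isPath b) x hx hK _ _
        (F.fiberPoint_mem c hζ u (F.map_mem a hx) (F.map_mem_K a hx hK))
        (F.fiberPoint_mem c hζ v (F.map_mem b hx) (F.map_mem_K b hx hK)))
      exact mul_le_of_le_one_left hσ.le (pow_le_one₀ hr.le F.r_lt_one.le)

theorem tendsto_scale {g : ℝ} (hg : 0 < g) :
    Tendsto (fun m : ℕ => F.r ^ m * g / 2) atTop (𝓝[>] 0) := by
  have hr := F.r_pos
  rw [tendsto_nhdsWithin_iff]
  refine ⟨?_, Eventually.of_forall fun m => by simp only [mem_Ioi]; positivity⟩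
  have := ((tendsto_pow_atTop_nhds_zero_of_lt_one hr.le F.r_lt_one).mul_const g).div_const 2
  simpa using this

theorem scale_rpow_le {g : ℝ} (hg : 0 < g) (m : ℕ) :
    (g / 2) ^ t * (F.r ^ m * g / 2) ^ (-t) ≤ (F.M : ℝ) ^ m := by
  have hr := F.r_pos
  have hg2 : (0 : ℝ) < g / 2 := by positivity
  have h0 : (g / 2) ^ t ≠ 0 := (Real.rpow_pos_of_pos hg2 t).ne'
  calc (g / 2) ^ t * (F.r ^ m * g / 2) ^ (-t) = (F.r ^ m) ^ (-t) := by
        rw [mul_div_assoc, Real.mul_rpow (by positivity) hg2.le, Real.rpow_neg hg2.le]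
        field_simp
    _ = (F.r ^ (-t)) ^ m := by
        rw [← Real.rpow_natCast, ← Real.rpow_mul hr.le, ← Real.rpow_natCast (F.r ^ (-t)),
          ← Real.rpow_mul hr.le, mul_comm]
    _ ≤ _ := by
        have := Real.rpow_pos_of_pos hr (-t)
        gcongr
        exact F.le_M

theorem packingBound_K (F : S.LoopFamily t) (c : S.Constants τ) : PackingBound S.K t := by
  obtain ⟨g, hg, hgap⟩ := F.exists_gap c
  refine ⟨(g / 2) ^ t, by positivity, _, F.tendsto_scale hg, fun m => ?_⟩
  refine ⟨List.Vector (Fin F.M) m, inferInstance, fun u => u.1.foldr F.map F.x₀,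
    fun u => (F.foldr_map_mem u.1).1, fun u v huv => ?_, ?_⟩
  · have := foldr_separated (f := F.map) (fun a x hx => F.map_mem a hx) F.r_pos F.r_lt_one.le
      F.le_wordMap hg hgap F.x₀_mem (u.2.trans v.2.symm) (Subtype.val_injective.ne huv)
    rw [u.2] at this
    rw [Real.dist_eq]
    linarith
  · rw [card_vector, Fintype.card_fin, Nat.cast_pow]
    exact F.scale_rpow_le hg m

/-- A pair `(u, v)` gives the base point with past `u` and, over it, the fibre point with future
`v`. Different pasts separate first coordinates; with equal pasts the base point is the same and
different futures separate second coordinates. -/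
theorem packingBound_phaseTrappedPlane (F : S.LoopFamily t) (c : S.Constants τ) (hA : S.A.IsSymm)
    (hcap : S.MinimallyCaptive τ) : PackingBound (S.phaseTrappedPlane τ) (2 * t) := by
  obtain ⟨g₁, hg₁, hgap₁⟩ := F.exists_gap c
  obtain ⟨σ, hσ, hgap₂⟩ := hcap.exists_fiber_gap c F.n
  have hζ : ∀ x, ∃ ξ, x ∈ S.K → (x, ξ) ∈ S.phaseTrapped τ := fun x => by
    by_cases hx : x ∈ S.K
    · obtain ⟨ξ, hξ⟩ := exists_mem_phaseTrapped c hA hx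
      exact ⟨ξ, fun _ => hξ⟩
    · exact ⟨0, fun h => (hx h).elim⟩
  choose ζ hζ using hζ
  set g := min g₁ σ with hgdef
  have hg : 0 < g := lt_min hg₁ hσ
  have hr := F.r_pos
  refine ⟨((g / 2) ^ t) ^ 2, by positivity, _, F.tendsto_scale hg, fun m => ?_⟩
  refine ⟨List.Vector (Fin F.M) m × List.Vector (Fin F.M) m, inferInstance,
    fun p => !₂[p.1.1.foldr F.map F.x₀, F.fiberPoint τ ζ p.2.1 (p.1.1.foldr F.map F.x₀)],
    fun p => ⟨_, F.fiberPoint_mem c hζ p.2.1 (F.foldr_map_mem p.1.1).2 (F.foldr_map_mem p.1.1).1,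
      rfl⟩, ?_, ?_⟩
  · rintro ⟨u, v⟩ ⟨u', v'⟩ hne
    by_cases huu : u = u'
    · subst huu
      have hvv : v ≠ v' := fun h => hne (by rw [h])
      have hmem := F.foldr_map_mem u.1
      have := F.fiberPoint_separated c hζ hσ hgap₂ (v.2.trans v'.2.symm)
        (Subtype.val_injective.ne hvv) hmem.2 hmem.1
      rw [v.2] at this
      refine le_trans ?_ (abs_snd_sub_le_dist_plane _ _ _ _)
      have h2 : F.r ^ m * g ≤ F.r ^ m * σ := by gcongr; exact min_le_right _ _
      linarith
    · have := foldr_separated (f := F.map) (fun a x hx => F.map_mem a hx) F.r_pos F.r_lt_one.le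
        F.le_wordMap hg₁ hgap₁ F.x₀_mem (u.2.trans u'.2.symm) (Subtype.val_injective.ne huu)
      rw [u.2] at this
      refine le_trans ?_ (abs_fst_sub_le_dist_plane _ _ _ _)
      have h2 : F.r ^ m * g ≤ F.r ^ m * g₁ := by gcongr; exact min_le_left _ _
      linarith
  · have h1 := F.scale_rpow_le hg m
    have hs : (0 : ℝ) < F.r ^ m * g / 2 := by positivity
    rw [Fintype.card_prod, card_vector, Fintype.card_fin, Nat.cast_mul, Nat.cast_pow, ← sq]
    calc ((g / 2) ^ t) ^ 2 * (F.r ^ m * g / 2) ^ (-(2 * t))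
        = ((g / 2) ^ t * (F.r ^ m * g / 2) ^ (-t)) ^ 2 := by
          rw [mul_pow, ← Real.rpow_natCast ((F.r ^ m * g / 2) ^ (-t)), ← Real.rpow_mul hs.le]
          congr 2
          push_cast; ring
      _ ≤ _ := by gcongr

end LoopFamily

end IteratedFunctionScheme

-- Counting paths and upper bounds.

namespace IteratedFunctionScheme

variable {N : ℕ} {S : IteratedFunctionScheme N} {τ : ℝ → ℝ}

/-- The absolute value of the derivative of `wordMap i l` at the left end point of `I_i`. -/
noncomputable def weight (S : IteratedFunctionScheme N) (i : Fin N) (l : List (Fin N)) : ℝ :=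
  |S.wordDeriv i l (S.a i)|

theorem a_mem (i : Fin N) : S.a i ∈ S.interval i := left_mem_Icc.2 (S.a_lt_b i).le

namespace Constants

variable (c : S.Constants τ)

theorem Δ_nonneg : 0 ≤ c.Δ :=
  (abs_nonneg _).trans (c.diam_le ⟨0, S.one_le⟩ _ (a_mem _) _ (a_mem _))

theorem one_le_Q : 1 ≤ c.Q := Real.one_le_exp (mul_nonneg c.β_nonneg c.Δ_nonneg)

theorem weight_le_pow {i : Fin N} {l : List (Fin N)} (h : S.IsPath i l) :
    S.weight i l ≤ c.θ ^ l.length := c.abs_wordDeriv_le h (a_mem i)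

/-- The least ratio by which the weight of a path changes when an edge is added. -/
noncomputable def μ : ℝ := min 1 c.κ / c.Q

theorem μ_pos : 0 < c.μ := div_pos (lt_min one_pos c.κ_pos) c.Q_pos

theorem μ_le_one : c.μ ≤ 1 :=
  div_le_one_of_le₀ ((min_le_left _ _).trans c.one_le_Q) c.Q_pos.le

theorem μ_le_κ : c.μ ≤ c.κ :=
  div_le_of_le_mul₀ c.Q_pos.le c.κ_pos.le
    ((min_le_right _ _).trans (le_mul_of_one_le_right c.κ_pos.le c.one_le_Q))

theorem μ_mul_Q_le : c.μ * c.Q ≤ c.κ := by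
  rw [μ, div_mul_cancel₀ _ c.Q_pos.ne']
  exact min_le_right _ _

/-- The tail is weighed at the left end point of its own interval rather than at the image of the
previous one; the factor `Q` in `μ` pays for this change of base point. -/
theorem μ_mul_weight_le_cons {i j : Fin N} {l : List (Fin N)} (h : S.IsPath i (j :: l)) :
    c.μ * S.weight j l ≤ S.weight i (j :: l) := by
  have hμ := c.μ_pos
  have hκ := c.κ_pos
  have h1 := c.abs_wordDeriv_le_Q h.2 (a_mem j) (φ_mem h.1 (a_mem i))
  have h2 := c.le_dφ i j h.1 _ (a_mem i)
  simp only [weight, wordDeriv, abs_mul]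
  calc _ ≤ c.μ * (c.Q * |S.wordDeriv j l (S.φ i j (S.a i))|) := by gcongr
    _ = (c.μ * c.Q) * |S.wordDeriv j l (S.φ i j (S.a i))| := by ring
    _ ≤ _ := by gcongr; exact c.μ_mul_Q_le.trans h2

theorem μ_mul_weight_le_concat {i j : Fin N} {l : List (Fin N)} (h : S.IsPath i (l ++ [j])) :
    c.μ * S.weight i l ≤ S.weight i (l ++ [j]) := by
  rw [isPath_append] at h
  have hμ := c.μ_pos
  have h2 := c.le_dφ _ j h.2.1 _ (wordMap_mem h.1 (a_mem i))
  simp only [weight, wordDeriv_append, abs_mul, wordDeriv, mul_one]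
  rw [mul_comm]
  gcongr
  exact c.μ_le_κ.trans h2

/-- Letters are dropped from the front until one more would push the weight above `δ`. The most
recent past is kept, so the terminal point does not change; `δ < 1` rules out the empty word, of
weight `1`. -/
theorem exists_suffix_of_weight_le {δ : ℝ} (hδ : δ < 1) {i : Fin N} {l : List (Fin N)}
    (h : S.IsPath i l) (hw : S.weight i l ≤ δ) {y : ℝ} (hy : y ∈ S.K ∩ S.interval i) :
    ∃ i' l', S.IsPath i' l' ∧ c.μ * δ ≤ S.weight i' l' ∧ S.weight i' l' ≤ δ ∧
      ∃ y' ∈ S.K ∩ S.interval i', S.wordMap i' l' y' = S.wordMap i l y := by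
  induction l generalizing i y with
  | nil =>
    simp only [weight, wordDeriv, abs_one] at hw
    linarith
  | cons j l ih =>
    by_cases hj : S.weight j l ≤ δ
    · exact ih h.2 hj ⟨wordMap_mem_K (l := [j]) ⟨h.1, trivial⟩ hy.2 hy.1, φ_mem h.1 hy.2⟩
    · refine ⟨i, j :: l, h, le_trans ?_ (c.μ_mul_weight_le_cons h), hw, y, hy, rfl⟩
      have := c.μ_pos
      gcongr
      exact (not_le.1 hj).le

theorem exists_prefix_of_weight_le {δ : ℝ} (hδ : δ < 1) {i : Fin N} {l : List (Fin N)}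
    (h : S.IsPath i l) (hw : S.weight i l ≤ δ) :
    ∃ l₁ l₂, l = l₁ ++ l₂ ∧ c.μ * δ ≤ S.weight i l₁ ∧ S.weight i l₁ ≤ δ := by
  induction l using List.reverseRecOn with
  | nil =>
    simp only [weight, wordDeriv, abs_one] at hw
    linarith
  | append_singleton l j ih =>
    by_cases hj : S.weight i l ≤ δ
    · obtain ⟨l₁, l₂, rfl, h1, h2⟩ := ih (isPath_append.1 h).1 hj
      exact ⟨l₁, l₂ ++ [j], by simp, h1, h2⟩
    · refine ⟨l ++ [j], [], by simp, le_trans ?_ (c.μ_mul_weight_le_concat h), hw⟩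
      have := c.μ_pos
      gcongr
      exact (not_le.1 hj).le

theorem card_loops_le {t : ℝ} (hloops : ¬ S.HasLoops t) {i : Fin N}
    (hi : (S.K ∩ S.interval i).Nonempty) {ρ : ℝ} (hρ : 0 < ρ) (hρ1 : ρ < 1) (n : ℕ)
    (W : Finset (List (Fin N))) (hW : ∀ l ∈ W, l.length = n ∧ S.IsPath i l ∧ endpoint i l = i ∧
      ρ ≤ S.weight i l) : (W.card : ℝ) ≤ (ρ / c.Q ^ 2) ^ (-t) := by
  have hQ := c.Q_pos
  have hQ1 := c.one_le_Q
  by_contra! hlt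
  -- One factor `Q` moves the derivative bound away from the left end point, the other passes from
  -- derivatives to differences.
  refine hloops ⟨i, hi, n, ρ / c.Q ^ 2, by positivity, ?_, W, hlt.le, fun l hl => ?_⟩
  · exact (div_le_self hρ.le (one_le_pow₀ hQ1)).trans_lt hρ1
  · obtain ⟨hlen, hpath, hend, hw⟩ := hW l hl
    have hD : ∀ x ∈ S.interval i, ρ / c.Q ≤ |S.wordDeriv i l x| := fun x hx => by
      rw [div_le_iff₀' hQ]
      exact hw.trans (c.abs_wordDeriv_le_Q hpath (a_mem i) hx)
    refine ⟨hlen, hpath, hend, fun x hx => ⟨le_trans ?_ (hD x hx), fun y hy => ?_⟩⟩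
    · exact div_le_div_of_nonneg_left hρ.le hQ (by nlinarith)
    · have h1 := c.le_abs_wordMap_sub_Q hpath hx hy
      calc ρ / c.Q ^ 2 * |x - y| = (ρ / c.Q * |x - y|) / c.Q := by field_simp
        _ ≤ (|S.wordDeriv i l x| * |x - y|) / c.Q := by gcongr; exact hD x hx
        _ ≤ _ := by rwa [div_le_iff₀' hQ]

/-- Symmetry makes every path reversible. One return path is fixed for each pair of vertices; there
are finitely many pairs, so return lengths and weight losses are bounded. Dependence on the end
points alone keeps the closing operation injective on paths with given ends. -/
theorem exists_return_paths (c : S.Constants τ) (hA : S.A.IsSymm) : ∃ (p : Fin N → Fin N → List (Fin N)) (α : ℝ),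
    0 < α ∧ α ≤ 1 ∧ ∀ i l, S.IsPath i l → S.IsPath i (l ++ p i (endpoint i l)) ∧
      endpoint i (l ++ p i (endpoint i l)) = i ∧
      α * S.weight i l ≤ S.weight i (l ++ p i (endpoint i l)) := by
  have hex : ∀ i j, ∃ p, (∃ p', S.IsPath j p' ∧ endpoint j p' = i) →
      S.IsPath j p ∧ endpoint j p = i := fun i j => by
    by_cases h : ∃ p', S.IsPath j p' ∧ endpoint j p' = i
    · obtain ⟨p, hp⟩ := h
      exact ⟨p, fun _ => hp⟩
    · exact ⟨[], fun h' => (h h').elim⟩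
  choose p hp using hex
  obtain ⟨m, hm⟩ := Finite.exists_le (fun q : Fin N × Fin N => (p q.1 q.2).length)
  have hκ := c.κ_pos
  refine ⟨p, min 1 c.κ ^ m, by positivity, pow_le_one₀ (by positivity) (min_le_left _ _),
    fun i l h => ?_⟩
  obtain ⟨h1, h2⟩ := hp i (endpoint i l) (exists_reverse_path hA h)
  refine ⟨isPath_append.2 ⟨h, h1⟩, (endpoint_append _ _ _).trans h2, ?_⟩
  simp only [weight, wordDeriv_append, abs_mul]
  rw [mul_comm]
  gcongr
  refine le_trans ?_ (c.le_abs_wordDeriv h1 (wordMap_mem h (a_mem i)))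
  calc min 1 c.κ ^ m ≤ min 1 c.κ ^ (p i (endpoint i l)).length :=
        pow_le_pow_of_le_one (by positivity) (min_le_left _ _) (hm (i, endpoint i l))
    _ ≤ _ := by gcongr; exact min_le_right _ _

theorem exists_card_paths_of_length_le (c : S.Constants τ) (hA : S.A.IsSymm) {t : ℝ} (hloops : ¬ S.HasLoops t) :
    ∃ α : ℝ, 0 < α ∧ ∀ i, (S.K ∩ S.interval i).Nonempty → ∀ ρ, 0 < ρ → ρ < 1 → ∀ n,
      ∀ W : Finset (List (Fin N)), (∀ l ∈ W, l.length = n ∧ S.IsPath i l ∧ ρ ≤ S.weight i l) →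
        (W.card : ℝ) ≤ N * (α * ρ) ^ (-t) := by
  obtain ⟨p, α, hα, hα1, hp⟩ := c.exists_return_paths hA
  have hQ := c.Q_pos
  refine ⟨α / c.Q ^ 2, by positivity, fun i hi ρ hρ hρ1 n W hW => ?_⟩
  have hfib : ∀ j, ((W.filter fun l => endpoint i l = j).card : ℝ) ≤
      (α / c.Q ^ 2 * ρ) ^ (-t) := by
    intro j
    have hinj : Function.Injective fun l : List (Fin N) => l ++ p i j :=
      List.append_left_injective _
    rw [← Finset.card_image_of_injective _ hinj,
      show α / c.Q ^ 2 * ρ = α * ρ / c.Q ^ 2 by ring]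
    refine c.card_loops_le hloops hi (by positivity)
      ((mul_le_of_le_one_left hρ.le hα1).trans_lt hρ1) (n + (p i j).length) _ fun l' hl' => ?_
    obtain ⟨l, hl, rfl⟩ := Finset.mem_image.1 hl'
    obtain ⟨hlW, rfl⟩ := Finset.mem_filter.1 hl
    obtain ⟨hlen, hpath, hw⟩ := hW l hlW
    obtain ⟨h1, h2, h3⟩ := hp i l hpath
    refine ⟨by simp [hlen], h1, h2, le_trans ?_ h3⟩
    gcongr
  calc (W.card : ℝ) = ∑ j, ((W.filter fun l => endpoint i l = j).card : ℝ) := by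
        rw [Finset.card_eq_sum_card_fiberwise (f := endpoint i) (t := Finset.univ)
          fun _ _ => Finset.mem_coe.2 (Finset.mem_univ _)]
        push_cast
        rfl
    _ ≤ ∑ _j : Fin N, (α / c.Q ^ 2 * ρ) ^ (-t) := Finset.sum_le_sum fun j _ => hfib j
    _ = _ := by simp

/-- Summing over lengths costs only the number of possible lengths, which is `O(ρ ^ (-(t' - t)))`;
this is where `t' > t` is used. -/
theorem exists_card_paths_le (c : S.Constants τ) (hA : S.A.IsSymm) {t t' : ℝ} (htt' : t < t')
    (hloops : ¬ S.HasLoops t) :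
    ∃ C : ℝ, ∀ i, (S.K ∩ S.interval i).Nonempty → ∀ ρ, 0 < ρ → ρ < 1 →
      ∀ W : Finset (List (Fin N)), (∀ l ∈ W, S.IsPath i l ∧ ρ ≤ S.weight i l) →
        (W.card : ℝ) ≤ C * ρ ^ (-t') := by
  obtain ⟨α, hα, h⟩ := c.exists_card_paths_of_length_le hA hloops
  set s := t' - t with hs
  have hs0 : 0 < s := sub_pos.2 htt'
  have hθ := c.θ_pos
  set b := c.θ ^ (-s) with hb
  have hb1 : 1 < b := Real.one_lt_rpow_of_pos_of_lt_one_of_neg hθ c.θ_lt_one (neg_lt_zero.2 hs0)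
  have hb0 : 0 < b - 1 := sub_pos.2 hb1
  refine ⟨N * α ^ (-t) * ((b - 1)⁻¹ + 1), fun i hi ρ hρ hρ1 W hW => ?_⟩
  have hρs : 1 ≤ ρ ^ (-s) := Real.one_le_rpow_of_pos_of_le_one_of_nonpos hρ hρ1.le
    (neg_nonpos.2 hs0.le)
  have hlen : ∀ l ∈ W, (l.length : ℝ) ≤ (b - 1)⁻¹ * ρ ^ (-s) := fun l hl => by
    obtain ⟨hpath, hw⟩ := hW l hl
    rw [← div_eq_inv_mul, le_div_iff₀ hb0]
    -- Bernoulli's inequality turns the exponential bound `ρ ≤ θ ^ l.length` into a bound on the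
    -- length by a small power of `1 / ρ`.
    have h1 : 1 + (l.length : ℝ) * (b - 1) ≤ b ^ l.length := by
      have := one_add_mul_le_pow (a := b - 1) (by linarith) l.length
      rwa [add_sub_cancel] at this
    have h2 : b ^ l.length = (c.θ ^ l.length) ^ (-s) := by
      rw [hb, ← Real.rpow_natCast, ← Real.rpow_natCast, ← Real.rpow_mul hθ.le,
        ← Real.rpow_mul hθ.le, mul_comm]
    have h3 : (c.θ ^ l.length) ^ (-s) ≤ ρ ^ (-s) :=
      Real.rpow_le_rpow_of_nonpos hρ (hw.trans (c.weight_le_pow hpath)) (neg_nonpos.2 hs0.le)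
    linarith
  have hcardimg : ((W.image List.length).card : ℝ) ≤ ((b - 1)⁻¹ + 1) * ρ ^ (-s) := by
    have hsub : W.image List.length ⊆ Finset.range (⌊(b - 1)⁻¹ * ρ ^ (-s)⌋₊ + 1) := by
      intro n hn
      obtain ⟨l, hl, rfl⟩ := Finset.mem_image.1 hn
      rw [Finset.mem_range, Nat.lt_succ_iff]
      exact Nat.le_floor (hlen l hl)
    have h1 : ((W.image List.length).card : ℝ) ≤ ⌊(b - 1)⁻¹ * ρ ^ (-s)⌋₊ + 1 := by
      have := Finset.card_le_card hsub
      rw [Finset.card_range] at this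
      exact_mod_cast this
    have h2 := Nat.floor_le (show 0 ≤ (b - 1)⁻¹ * ρ ^ (-s) by positivity)
    linarith
  calc (W.card : ℝ) = ∑ n ∈ W.image List.length, ((W.filter fun l => l.length = n).card : ℝ) := by
        rw [Finset.card_eq_sum_card_image List.length W]
        push_cast
        rfl
    _ ≤ ∑ _n ∈ W.image List.length, N * (α * ρ) ^ (-t) := by
        refine Finset.sum_le_sum fun n _ => h i hi ρ hρ hρ1 n _ fun l hl => ?_
        obtain ⟨hlW, hn⟩ := Finset.mem_filter.1 hl
        exact ⟨hn, hW l hlW⟩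
    _ = (W.image List.length).card * (N * (α * ρ) ^ (-t)) := by
        rw [Finset.sum_const, nsmul_eq_mul]
    _ ≤ (((b - 1)⁻¹ + 1) * ρ ^ (-s)) * (N * (α * ρ) ^ (-t)) := by gcongr
    _ = N * α ^ (-t) * ((b - 1)⁻¹ + 1) * (ρ ^ (-s) * ρ ^ (-t)) := by
        rw [Real.mul_rpow hα.le hρ.le]; ring
    _ = _ := by
        rw [← Real.rpow_add hρ]
        congr 2
        rw [hs]; ring

theorem exists_finset_paths (c : S.Constants τ) (hA : S.A.IsSymm) {t t' : ℝ} (htt' : t < t')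
    (hloops : ¬ S.HasLoops t) :
    ∃ C : ℝ, ∀ ρ, 0 < ρ → ρ < 1 → ∃ W : Finset (Fin N × List (Fin N)),
      (W.card : ℝ) ≤ C * ρ ^ (-t') ∧ ∀ i l, (S.K ∩ S.interval i).Nonempty → S.IsPath i l →
        ρ ≤ S.weight i l → (i, l) ∈ W := by
  obtain ⟨C, hC⟩ := c.exists_card_paths_le hA htt' hloops
  refine ⟨N * |C|, fun ρ hρ hρ1 => ?_⟩
  have hfin : ∀ i, {l | (S.K ∩ S.interval i).Nonempty ∧ S.IsPath i l ∧
      ρ ≤ S.weight i l}.Finite := fun i => by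
    obtain ⟨n, hn⟩ := exists_pow_lt_of_lt_one hρ c.θ_lt_one
    refine (List.finite_length_le (Fin N) n).subset fun l hl => ?_
    change l.length ≤ n
    by_contra! hlt
    have h1 : c.θ ^ l.length ≤ c.θ ^ n :=
      pow_le_pow_of_le_one c.θ_pos.le c.θ_lt_one.le hlt.le
    linarith [c.weight_le_pow hl.2.1, hl.2.2]
  refine ⟨Finset.univ.biUnion fun i => (hfin i).toFinset.image (Prod.mk i), ?_, ?_⟩
  · have h1 : ∀ i, (((hfin i).toFinset.image (Prod.mk i)).card : ℝ) ≤ |C| * ρ ^ (-t') := fun i => by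
      rw [Finset.card_image_of_injective _ (Prod.mk_right_injective i)]
      by_cases hi : (S.K ∩ S.interval i).Nonempty
      · refine (hC i hi ρ hρ hρ1 _ fun l hl => ((hfin i).mem_toFinset.1 hl).2).trans ?_
        gcongr
        exact le_abs_self C
      · rw [Finset.card_eq_zero.2]
        · push_cast; positivity
        · exact Finset.eq_empty_of_forall_notMem fun l hl => hi ((hfin i).mem_toFinset.1 hl).1
    calc _ ≤ ((∑ i, ((hfin i).toFinset.image (Prod.mk i)).card : ℕ) : ℝ) :=
          Nat.cast_le.2 Finset.card_biUnion_le
      _ ≤ ∑ _i : Fin N, |C| * ρ ^ (-t') := by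
          push_cast
          exact Finset.sum_le_sum fun i _ => h1 i
      _ = _ := by simp [mul_assoc]
  · intro i l hi hpath hw
    exact Finset.mem_biUnion.2 ⟨i, Finset.mem_univ _, Finset.mem_image.2
      ⟨l, (hfin i).mem_toFinset.2 ⟨hi, hpath, hw⟩, rfl⟩⟩

theorem exists_word_of_scale {δ : ℝ} (hδ : 0 < δ) (hδ1 : δ < 1) {x : ℝ} (hx : x ∈ S.K) :
    ∃ i l, (S.K ∩ S.interval i).Nonempty ∧ S.IsPath i l ∧ c.μ * δ ≤ S.weight i l ∧
      x ∈ S.interval (endpoint i l) ∧ |x - S.wordMap i l (S.a i)| ≤ c.Q ^ 2 * c.Δ * δ := by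
  obtain ⟨n, hn⟩ := exists_pow_lt_of_lt_one hδ c.θ_lt_one
  obtain ⟨i, l, hl, hpath, y, hy, hyx⟩ := exists_word_of_mem_K hx n
  obtain ⟨i', l', hpath', h1, h2, y', hy', he⟩ := c.exists_suffix_of_weight_le hδ1 hpath
    ((c.weight_le_pow hpath).trans (by rw [hl]; exact hn.le)) hy
  obtain rfl : S.wordMap i' l' y' = x := he.trans hyx
  refine ⟨i', l', ⟨y', hy'⟩, hpath', h1, wordMap_mem hpath' hy'.2, ?_⟩
  have hQ := c.Q_pos
  have hΔ := c.Δ_nonneg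
  calc _ ≤ c.Q * |S.wordDeriv i' l' y'| * |y' - S.a i'| :=
        c.abs_wordMap_sub_le_Q hpath' hy'.2 (a_mem i')
    _ ≤ c.Q * (c.Q * δ) * c.Δ := by
        gcongr
        · refine (c.abs_wordDeriv_le_Q hpath' hy'.2 (a_mem i')).trans ?_
          gcongr
          exact h2
        · exact c.diam_le i' _ hy'.2 _ (a_mem i')
    _ = _ := by ring

theorem coverBound_K (c : S.Constants τ) (hA : S.A.IsSymm) {t t' : ℝ} (htt' : t < t')
    (hloops : ¬ S.HasLoops t) : CoverBound S.K t' := by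
  obtain ⟨C, hC⟩ := c.exists_finset_paths hA htt' hloops
  have hQ := c.Q_pos
  have hΔ := c.Δ_nonneg
  have hμ := c.μ_pos
  refine ⟨C * c.μ ^ (-t'), c.Q ^ 2 * c.Δ + 1, by positivity, fun δ hδ hδ1 => ?_⟩
  obtain ⟨W, hWcard, hW⟩ := hC (c.μ * δ) (by positivity)
    ((mul_le_of_le_one_left hδ.le c.μ_le_one).trans_lt hδ1)
  refine ⟨W.image fun p => S.wordMap p.1 p.2 (S.a p.1), ?_, fun x hx => ?_⟩
  · calc _ ≤ (W.card : ℝ) := Nat.cast_le.2 Finset.card_image_le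
      _ ≤ C * (c.μ * δ) ^ (-t') := hWcard
      _ = _ := by rw [Real.mul_rpow hμ.le hδ.le, mul_assoc]
  · obtain ⟨i, l, hi, hpath, hw, -, hd⟩ := c.exists_word_of_scale hδ hδ1 hx
    refine ⟨_, Finset.mem_image.2 ⟨(i, l), hW i l hi hpath hw, rfl⟩, ?_⟩
    rw [Real.dist_eq]
    refine hd.trans ?_
    gcongr
    linarith

/-- The future is cut where its weight reaches `δ`; replacing the rest by the zero section changes
`ξ` by the derivative of the prefix times a bounded quantity. -/
theorem exists_fiber_word_of_scale {δ : ℝ} (hδ : 0 < δ) (hδ1 : δ < 1) {p : ℝ × ℝ}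
    (hp : p ∈ S.phaseTrapped τ) :
    ∃ i l, p.1 ∈ S.K ∩ S.interval i ∧ S.IsPath i l ∧ c.μ * δ ≤ S.weight i l ∧
      |p.2 - S.pull τ i l p.1 0| ≤ c.Q * (c.R + 1) * δ := by
  obtain ⟨hK, M, hM⟩ := (mem_phaseTrapped_iff c).1 hp
  have hμ := c.μ_pos
  have hθ := c.θ_pos
  have hQ := c.Q_pos
  have hR := c.R_nonneg
  -- The bound `M` depends on the point `p`. The future is taken so long that the part after the cut
  -- contracts `|η|` to at most `1`, which makes the final constant independent of `p`.
  obtain ⟨n, hn⟩ := exists_pow_lt_of_lt_one (show 0 < c.μ * δ / (|M| + 1) by positivity) c.θ_lt_one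
  rw [lt_div_iff₀ (by positivity)] at hn
  have hθn : 0 < c.θ ^ n := by positivity
  obtain ⟨i, l, η, hl, hpath, hi, hη, hpull⟩ := hM n
  have hwle : S.weight i l ≤ δ := by
    refine (c.weight_le_pow hpath).trans ?_
    rw [hl]
    have h1 : c.μ * δ ≤ δ := mul_le_of_le_one_left hδ.le c.μ_le_one
    have h2 : 0 ≤ c.θ ^ n * |M| := by positivity
    linarith
  obtain ⟨l₁, l₂, rfl, h1, h2⟩ := c.exists_prefix_of_weight_le hδ1 hpath hwle
  rw [isPath_append] at hpath
  refine ⟨i, l₁, ⟨hK, hi⟩, hpath.1, h1, ?_⟩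
  rw [hpull, pull_append, pull_sub_pull, sub_zero, abs_mul]
  have h3 : |S.wordDeriv i l₁ p.1| ≤ c.Q * δ :=
    (c.abs_wordDeriv_le_Q hpath.1 hi (a_mem i)).trans (by gcongr; exact h2)
  have h4 : c.θ ^ l₂.length * |η| ≤ 1 := by
    have h5 : c.μ * δ ≤ c.θ ^ l₁.length := h1.trans (c.weight_le_pow hpath.1)
    have h6 : |η| ≤ |M| + 1 := by linarith [le_abs_self M]
    have h7 : c.θ ^ l₁.length * (c.θ ^ l₂.length * (|M| + 1)) ≤ c.θ ^ l₁.length * 1 := by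
      rw [← mul_assoc, ← pow_add, ← List.length_append, hl]
      linarith
    refine le_trans ?_ (le_of_mul_le_mul_left h7 (by positivity))
    gcongr
  calc _ ≤ (c.Q * δ) * (c.R + 1) := by
        gcongr
        exact (c.abs_pull_le hpath.2 (wordMap_mem hpath.1 hi) η).trans (by linarith)
    _ = _ := by ring

theorem coverBound_phaseTrappedPlane (c : S.Constants τ) (hA : S.A.IsSymm) {t t' : ℝ}
    (htt' : t < t') (hloops : ¬ S.HasLoops t) : CoverBound (S.phaseTrappedPlane τ) (2 * t') := by
  obtain ⟨C, hC⟩ := c.exists_finset_paths hA htt' hloops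
  have hQ := c.Q_pos
  have hΔ := c.Δ_nonneg
  have hμ := c.μ_pos
  have hR := c.R_nonneg
  have hΛ := c.Λ_nonneg
  refine ⟨(C * c.μ ^ (-t')) ^ 2,
    c.Q ^ 2 * c.Δ + (c.Q * (c.R + 1) + c.Λ * (c.Q ^ 2 * c.Δ)), by positivity, fun δ hδ hδ1 => ?_⟩
  obtain ⟨W, hWcard, hW⟩ := hC (c.μ * δ) (by positivity)
    ((mul_le_of_le_one_left hδ.le c.μ_le_one).trans_lt hδ1)
  classical
  -- The second coordinate of a centre is computed over the first one instead of over `p.1`; the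
  -- Lipschitz constant `Λ`, uniform over words, absorbs the difference.
  refine ⟨(W ×ˢ W).image fun q => !₂[S.wordMap q.1.1 q.1.2 (S.a q.1.1),
    S.pull τ q.2.1 q.2.2 (S.wordMap q.1.1 q.1.2 (S.a q.1.1)) 0], ?_, ?_⟩
  · calc _ ≤ ((W ×ˢ W).card : ℝ) := Nat.cast_le.2 Finset.card_image_le
      _ = (W.card : ℝ) ^ 2 := by rw [Finset.card_product]; push_cast; ring
      _ ≤ (C * (c.μ * δ) ^ (-t')) ^ 2 := by gcongr
      _ = (C * c.μ ^ (-t')) ^ 2 * (δ ^ (-t')) ^ 2 := by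
          rw [Real.mul_rpow hμ.le hδ.le]; ring
      _ = _ := by
          rw [← Real.rpow_natCast (δ ^ (-t')), ← Real.rpow_mul hδ.le]
          congr 2
          push_cast; ring
  · rintro _ ⟨p, hp, rfl⟩
    obtain ⟨k, v, hk, hv, hwv, hdv⟩ := c.exists_fiber_word_of_scale hδ hδ1 hp
    obtain ⟨i, u, hi, hu, hwu, hend, hdu⟩ := c.exists_word_of_scale hδ hδ1 hk.1
    obtain rfl := eq_of_mem_interval hk.2 hend
    refine ⟨_, Finset.mem_image.2 ⟨((i, u), (endpoint i u, v)), Finset.mem_product.2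
      ⟨hW _ _ hi hu hwu, hW _ _ ⟨p.1, hk⟩ hv hwv⟩, rfl⟩, ?_⟩
    refine (dist_plane_le _ _ _ _).trans ?_
    have h1 := c.abs_pull_zero_sub_le hv hk.2 (wordMap_mem hu (a_mem i))
    have h2 : c.Λ * |p.1 - S.wordMap i u (S.a i)| ≤ c.Λ * (c.Q ^ 2 * c.Δ * δ) := by gcongr
    have h3 := abs_sub_le p.2 (S.pull τ (endpoint i u) v p.1 0)
      (S.pull τ (endpoint i u) v (S.wordMap i u (S.a i)) 0)
    simp only
    linarith

end Constants

end IteratedFunctionScheme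

-- Comparison with the common threshold.

theorem mainTheorem5 (N : ℕ) (S : IteratedFunctionScheme N) (τ : ℝ → ℝ)
    (hτ : ContDiffOn ℝ ∞ τ S.I) (hcap : S.MinimallyCaptive τ) (hA : S.A.IsSymm)
    (hK : S.K.Nonempty) :
    minkowskiDim (S.phaseTrappedPlane τ) = 2 * minkowskiDim S.K ∧
      2 * minkowskiDim S.K = 2 * ((dimH S.K : ℝ≥0∞) : EReal) := by
  obtain ⟨c⟩ := IteratedFunctionScheme.nonempty_constants hτ
  have hlow : ∀ t : ℝ, 0 < t → S.HasLoops t → (t : EReal) ≤ ((dimH S.K : ℝ≥0∞) : EReal) ∧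
      (t : EReal) ≤ minkowskiDim S.K ∧
      ((2 * t : ℝ) : EReal) ≤ minkowskiDim (S.phaseTrappedPlane τ) := by
    intro t ht h
    obtain ⟨F⟩ := h.nonempty_loopFamily ht
    refine ⟨?_, (F.packingBound_K c).le_minkowskiDim,
      (F.packingBound_phaseTrappedPlane c hA hcap).le_minkowskiDim⟩
    have := EReal.coe_ennreal_le_coe_ennreal_iff.2 (F.le_dimH c ht)
    rwa [EReal.coe_ennreal_ofReal, max_eq_left ht.le] at this
  have hup : ∀ t t' : ℝ, 0 < t → t < t' → ¬ S.HasLoops t →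
      ((dimH S.K : ℝ≥0∞) : EReal) ≤ (t' : EReal) ∧ minkowskiDim S.K ≤ (t' : EReal) ∧
      minkowskiDim (S.phaseTrappedPlane τ) ≤ ((2 * t' : ℝ) : EReal) := by
    intro t t' ht htt' h
    have hcov := c.coverBound_K hA htt' h
    refine ⟨?_, hcov.minkowskiDim_le, (c.coverBound_phaseTrappedPlane hA htt' h).minkowskiDim_le⟩
    have := EReal.coe_ennreal_le_coe_ennreal_iff.2 (hcov.dimH_le (ht.trans htt'))
    rwa [EReal.coe_ennreal_ofReal, max_eq_left (ht.trans htt').le] at this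
  have hX0 : (0 : EReal) ≤ ((dimH S.K : ℝ≥0∞) : EReal) := EReal.coe_ennreal_nonneg _
  have hY0 : ((0 : ℝ) : EReal) ≤ minkowskiDim S.K := (packingBound_zero hK).le_minkowskiDim
  have hZ0 : ((0 : ℝ) : EReal) ≤ minkowskiDim (S.phaseTrappedPlane τ) := by
    obtain ⟨x, hx⟩ := hK
    obtain ⟨ξ, hξ⟩ := IteratedFunctionScheme.exists_mem_phaseTrapped c hA hx
    have hne : (S.phaseTrappedPlane τ).Nonempty := ⟨_, _, hξ, rfl⟩
    exact (packingBound_zero hne).le_minkowskiDim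
  have hX1 : ((dimH S.K : ℝ≥0∞) : EReal) ≤ ((1 : ℝ) : EReal) := by
    have h1 : dimH S.K ≤ 1 := (dimH_mono (subset_univ _)).trans Real.dimH_univ.le
    simpa using EReal.coe_ennreal_le_coe_ennreal_iff.2 h1
  -- Exponent `2` exceeds the dimension of the line, so the upper bounds apply there and all three
  -- dimensions are finite reals.
  have h2 : ¬ S.HasLoops 2 := fun h => by
    have := (hlow 2 two_pos h).1.trans hX1
    rw [EReal.coe_le_coe_iff] at this
    norm_num at this
  obtain ⟨-, hY3, hZ3⟩ := hup 2 3 two_pos (by norm_num) h2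
  generalize ((dimH S.K : ℝ≥0∞) : EReal) = X at *
  generalize minkowskiDim S.K = Y at *
  generalize minkowskiDim (S.phaseTrappedPlane τ) = Z at *
  lift X to ℝ using ⟨ne_top_of_le_ne_top (EReal.coe_ne_top _) hX1, fun h => by simp [h] at hX0⟩
  lift Y to ℝ using ⟨ne_top_of_le_ne_top (EReal.coe_ne_top _) hY3, fun h => by simp [h] at hY0⟩
  lift Z to ℝ using ⟨ne_top_of_le_ne_top (EReal.coe_ne_top _) hZ3, fun h => by simp [h] at hZ0⟩
  have hX0' : (0 : ℝ) ≤ X := by exact_mod_cast hX0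
  simp only [EReal.coe_le_coe_iff] at hlow hup hY0 hZ0
  -- If `a < b`, take `a < t < t' < b`: loops at `t` contradict the bound on `a`, and their absence
  -- contradicts the bound on `b`. It is applied in both directions to each pair.
  have key : ∀ a b : ℝ, 0 ≤ a → (∀ t, 0 < t → S.HasLoops t → t ≤ a) →
      (∀ t t', 0 < t → t < t' → ¬ S.HasLoops t → b ≤ t') → b ≤ a := by
    intro a b ha h₁ h₂
    by_contra! hlt
    obtain ⟨t, hat, htb⟩ := exists_between hlt
    obtain ⟨t', htt', htb'⟩ := exists_between htb
    by_cases h : S.HasLoops t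
    · exact absurd (h₁ t (ha.trans_lt hat) h) (not_le.2 hat)
    · exact absurd (h₂ t t' (ha.trans_lt hat) htt' h) (not_le.2 htb')
  have hYX : Y ≤ X := key X Y hX0' (fun t ht h => (hlow t ht h).1)
    fun t t' ht htt' h => (hup t t' ht htt' h).2.1
  have hXY : X ≤ Y := key Y X hY0 (fun t ht h => (hlow t ht h).2.1)
    fun t t' ht htt' h => (hup t t' ht htt' h).1
  have hZY : Z / 2 ≤ Y := key Y (Z / 2) hY0 (fun t ht h => (hlow t ht h).2.1)
    fun t t' ht htt' h => by linarith [(hup t t' ht htt' h).2.2]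
  have hYZ : Y ≤ Z / 2 := key (Z / 2) Y (by positivity)
    (fun t ht h => by linarith [(hlow t ht h).2.2]) fun t t' ht htt' h => (hup t t' ht htt' h).2.1
  have e1 : Z = 2 * Y := by linarith
  have e2 : Y = X := le_antisymm hYX hXY
  subst e2 e1
  exact ⟨by norm_cast, rfl⟩
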